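/- Let $k\ge 4$ be even, $n\ge 1$ and $m\ge 0$. All hypergraphs are finite. A $k$-uniform hypergraph $G$ has adjacency tensor $\mathcal A(G)$ of order $k$, indexed by $V(G)$, with entry $a_{i_1\cdots i_k}=\frac1{(k-1)!}$ if $\{i_1,\dots,i_k\}\in E(G)$ and $0$ otherwise. A real number $\lambda$ is an H-eigenvalue of $\mathcal A(G)$ if there is a real vector $x\neq 0$ with $\sum_{i_2,\dots,i_k} a_{i i_2\cdots i_k}x_{i_2}\cdots x_{i_k}=\lambda x_i^{k-1}$ for all $i\in V(G)$; the least one is denoted $\lambda_{\min}(G)$. The coalescence $G_1(v_1)\diamond G_2(v_2)$ is obtained from vertex-disjoint $G_1,G_2$ by identifying the vertex $v_1$ of $G_1$ with the vertex $v_2$ of $G_2$. A hypertree is a connected hypergraph without (Berge) cycles; a single vertex is allowed. Let $C=C_{2n+1}^{k,k/2}$ be the $k$-uniform hypergraph obtained from the cycle $C_{2n+1}$ by replacing each vertex by a set of $k/2$ vertices (these sets being pairwise disjoint) and each edge $\{i,j\}$ by the union of the sets replacing $i$ and $j$. Let $\mathcal T_m(C)$ be the class of hypergraphs that, up to isomorphism,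 are obtained from $C$ by attaching $k$-uniform hypertrees at vertices of $C$ (each time identifying a vertex of a hypertree with a vertex of $C$), such that the total number of edges is $|E(C)|+m$. Let $S_m^k$ be the hyperstar with $m$ edges, obtained from the star with $m$ edges by adding $k-2$ new vertices to each edge ($S_0^k$ is a single vertex), and for a vertex $u$ of $C$ let $C(u)\diamond S_m^k(u)$ be the coalescence of $C$ and $S_m^k$ in which $u$ is identified with the centre of $S_m^k$. Then $C$ is non-odd-bipartite, i.e. there is no bipartition $\{V_1,V_2\}$ of $V(C)$ such that every edge of $C$ meets $V_1$ in an odd number of vertices. Moreover, every hypergraph in $\mathcal T_m(C)$ has a least H-eigenvalue, and for every vertex $u$ of $C$ the hypergraph $C(u)\diamond S_m^k(u)$ is, up to isomorphism, the unique minimizing hypergraph in $\mathcal T_m(C)$: a hypergraph $G$ belongs to $\mathcal T_m(C)$ and satisfies $\lambda_{\min}(G)=\min\{\lambda_{\min}(G') : G'\in\mathcal T_m(C)\}$ if and only if $G$ is isomorphic to $C(u)\diamond S_m^k(u)$. -/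

import Mathlib

open scoped Hypergraph

namespace Hypergraph

/-- Every edge has exactly `k` vertices. -/
def IsUniform {α : Type} (G : Hypergraph α) (k : ℕ) : Prop :=
  ∀ e ∈ E(G), e.encard = k

/-- Any two vertices are joined by a walk `v₀ e₁ v₁ e₂ … e_l v_l` with `v_{i-1}, v_i ∈ e_i`. -/
def IsConnected {α : Type} (G : Hypergraph α) : Prop :=
  V(G).Nonempty ∧ ∀ u ∈ V(G), ∀ v ∈ V(G), Relation.ReflTransGen G.Adj u v

/-- There is no (Berge) cycle `v₀ e₀ v₁ e₁ … v_{l-1} e_{l-1} v₀`, that is, no cyclic sequence of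
`l ≥ 2` distinct vertices and `l` distinct edges with `v_i, v_{i+1} ∈ e_i`
(addition in `Fin (l + 2)` is modulo `l + 2`). -/
def IsAcyclic {α : Type} (G : Hypergraph α) : Prop :=
  ¬ ∃ (l : ℕ) (v : Fin (l + 2) → α) (e : Fin (l + 2) → Set α),
    Function.Injective v ∧ Function.Injective e ∧
      ∀ i, e i ∈ E(G) ∧ v i ∈ e i ∧ v (i + 1) ∈ e i

/-- A (finite) hypertree: a connected acyclic hypergraph. A single vertex without edges counts. -/
def IsHypertree {α : Type} (T : Hypergraph α) : Prop :=
  V(T).Finite ∧ T.IsConnected ∧ T.IsAcyclic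

/-- `G` has a bipartition `{V₁, V₂}` of its vertex set with every edge meeting `V₁` in an odd number
of vertices. -/
def IsOddBipartite {α : Type} (G : Hypergraph α) : Prop :=
  ∃ V₁ V₂ : Set α, V₁ ∪ V₂ = V(G) ∧ Disjoint V₁ V₂ ∧ ∀ e ∈ E(G), Odd (e ∩ V₁).ncard

/-- Isomorphism: a map that is injective on the vertices carries `G` onto `H`. -/
def IsIsomorphic {α β : Type} (G : Hypergraph α) (H : Hypergraph β) : Prop :=
  ∃ f : α → β, Set.InjOn f V(G) ∧ G.image f = H

/-- The union of two hypergraphs on a common type of vertices. -/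
def union {α : Type} (G H : Hypergraph α) : Hypergraph α where
  vertexSet := V(G) ∪ V(H)
  edgeSet := E(G) ∪ E(H)
  subset_vertexSet_of_mem_edgeSet' := by
    rintro e (he | he)
    · exact (G.subset_vertexSet_of_mem_edgeSet' he).trans Set.subset_union_left
    · exact (H.subset_vertexSet_of_mem_edgeSet' he).trans Set.subset_union_right

open Classical in
/-- The coalescence `G₁(v₁) ◇ G₂(v₂)`: in the disjoint union of `G₁` and `G₂` the vertex `v₂` of `G₂`
is identified with the vertex `v₁` of `G₁` (the common vertex is represented by `Sum.inl v₁`). -/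
noncomputable def coalescence {α β : Type} (G₁ : Hypergraph α) (v₁ : α) (G₂ : Hypergraph β)
    (v₂ : β) : Hypergraph (α ⊕ β) :=
  (G₁.image Sum.inl).union (G₂.image fun x => if x = v₂ then Sum.inl v₁ else Sum.inr x)

/-- `AttachHypertrees k G₀ G ι`: the hypergraph `G` arises from `G₀` by finitely often identifying a
vertex of a `k`-uniform hypertree with a vertex of `G₀`; `ι` sends the vertices of `G₀` to the
corresponding vertices of `G`. -/
inductive AttachHypertrees (k : ℕ) {α₀ : Type} (G₀ : Hypergraph α₀) :
    {α : Type} → Hypergraph α → (α₀ → α) → Prop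
  | refl : AttachHypertrees k G₀ G₀ id
  | attach {α β : Type} {G : Hypergraph α} {ι : α₀ → α} {T : Hypergraph β} {v : α₀} {r : β} :
      AttachHypertrees k G₀ G ι → T.IsUniform k → T.IsHypertree → v ∈ V(G₀) → r ∈ V(T) →
      AttachHypertrees k G₀ (coalescence G (ι v) T r) (Sum.inl ∘ ι)

/-- Membership in the class `𝒯_m(G₀)`, which is closed under isomorphism: `G` is obtained from `G₀`
by attaching `k`-uniform hypertrees with `m` edges in total at vertices of `G₀`. -/
def MemT (k m : ℕ) {α₀ α : Type} (G₀ : Hypergraph α₀) (G : Hypergraph α) : Prop :=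
  ∃ (β : Type) (H : Hypergraph β) (ι : α₀ → β), AttachHypertrees k G₀ H ι ∧
    E(H).ncard = E(G₀).ncard + m ∧ H.IsIsomorphic G

/-- `(𝒜 x^{r})_i`, for a tensor `𝒜` of order `r + 1` with index set `I`. -/
def tensorApply {I : Type} [Fintype I] {r : ℕ} (A : (Fin (r + 1) → I) → ℝ) (x : I → ℝ) (i : I) : ℝ :=
  ∑ t : Fin r → I, A (Fin.cons i t) * ∏ j, x (t j)

/-- `c` is an H-eigenvalue of the tensor `A` of order `r + 1`: there is a real vector `x ≠ 0` with
`(𝒜 x^{r})_i = c * x_i ^ r` for all `i`. -/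
def IsHEigenvalue {I : Type} [Fintype I] {r : ℕ} (A : (Fin (r + 1) → I) → ℝ) (c : ℝ) : Prop :=
  ∃ x : I → ℝ, x ≠ 0 ∧ ∀ i, tensorApply A x i = c * x i ^ r

open Classical in
/-- The adjacency tensor of order `r + 1` of an `(r + 1)`-uniform hypergraph. -/
noncomputable def adjTensor {α : Type} (G : Hypergraph α) (r : ℕ) : (Fin (r + 1) → V(G)) → ℝ :=
  fun t => if Set.range (fun j => (t j : α)) ∈ E(G) then 1 / (r.factorial : ℝ) else 0

/-- `c` is the least H-eigenvalue of the adjacency tensor (of order `k = (k - 1) + 1`) of the finite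
`k`-uniform hypergraph `G`, where `k ≥ 1`. -/
def IsLeastHEigenvalue {α : Type} (k : ℕ) (G : Hypergraph α) (c : ℝ) : Prop :=
  ∃ _ : Fintype V(G), IsLeast {l : ℝ | IsHEigenvalue (G.adjTensor (k - 1)) l} c

/-- `G` is a minimizing hypergraph in `𝒯_m(G₀)`: its least H-eigenvalue is minimal among all
hypergraphs of the class (all of which have a least H-eigenvalue). -/
def IsMinimizing (k m : ℕ) {α₀ α : Type} (G₀ : Hypergraph α₀) (G : Hypergraph α) : Prop :=
  MemT k m G₀ G ∧ ∃ c : ℝ, IsLeastHEigenvalue k G c ∧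
    ∀ (β : Type) (G' : Hypergraph β), MemT k m G₀ G' →
      ∃ c' : ℝ, IsLeastHEigenvalue k G' c' ∧ c ≤ c'

/-- The `k`-th power of a simple graph: `k - 2` new vertices are added to every edge. -/
def power {W : Type} (H : SimpleGraph W) (k : ℕ) : Hypergraph (W ⊕ (H.edgeSet × Fin (k - 2))) where
  vertexSet := Set.univ
  edgeSet := {s | ∃ e : H.edgeSet,
    s = Sum.inl '' {w | w ∈ (e : Sym2 W)} ∪ Sum.inr '' {p | p.1 = e}}
  subset_vertexSet_of_mem_edgeSet' := fun _ _ => Set.subset_univ _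

/-- The blow-up of a simple graph: every vertex `w` is replaced by the `s`-set `{w} × Fin s`, and
every edge `{u, w}` by the union of the sets that replace `u` and `w`. -/
def blowUp {W : Type} (H : SimpleGraph W) (s : ℕ) : Hypergraph (W × Fin s) where
  vertexSet := Set.univ
  edgeSet := {e | ∃ u w, H.Adj u w ∧ e = {p | p.1 = u ∨ p.1 = w}}
  subset_vertexSet_of_mem_edgeSet' := fun _ _ => Set.subset_univ _

/-- The hyperstar `S_m^k`, the `k`-th power of the star with `m` edges. Its centre is
`Sum.inl 0`. -/
def hyperstar (m k : ℕ) :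
    Hypergraph (Fin (m + 1) ⊕ ((SimpleGraph.starGraph (0 : Fin (m + 1))).edgeSet × Fin (k - 2))) :=
  power (SimpleGraph.starGraph (0 : Fin (m + 1))) k

/-- The blown-up odd cycle `C_{2n+1}^{k,k/2}`. -/
def oddCycleBlowUp (n k : ℕ) : Hypergraph (Fin (2 * n + 1) × Fin (k / 2)) :=
  blowUp (SimpleGraph.cycleGraph (2 * n + 1)) (k / 2)

end Hypergraph

/-! Write `μ` for minus the least H-eigenvalue. For even `k` the least H-eigenvalue is the minimum
of the Rayleigh quotient `𝒜x^k / ∑ x_v^k`, so the question is for which `μ` the energy `𝒜x^k + μ ∑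
x_v^k` is nonnegative.

Let `q = μ^{-(k-1)}`. The inequality of arithmetic and geometric means on an edge with a
distinguished vertex `p` reads `k ∏ x_v + μ ∑_{v ≠ p} x_v^k ≥ -q x_p^k` (`edgeGap_nonneg_and`).
Rooting a hypertree and summing over its edges shows that a hypertree with `m` edges attached at `r`
contributes at least `-m q x_r^k` whenever `m ≤ μ^k` (`IsHypertree.branchEnergy_bound`). A star
centred at `r` attains this value; if `m < μ^k` and `x_r ≠ 0`, only a star does.

Every member of the class therefore has energy at least `C.energy z - ∑ n_v q z_v^k`, where `n_v`
counts the edges attached at `v` (`AttachHypertrees.exists_hasWeight`). Moving all the weight to a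
vertex `u` with `|z_u|` maximal only lowers this, and the result is nonnegative when `-μ` belongs to
the star coalescence at `u`. By vertex-transitivity of `C` this `μ` does not depend on `u`
(`exists_extremal`), so the star coalescences minimize.

In the case of equality, the weight sits where `|z|` is maximal. If two vertices carried weight, the
energy would be touched from below by both `m q z_v^k` and `m q z_w^k`; comparing derivatives in the
coordinate `w` gives `z_w = 0`, a contradiction (`eq_zero_of_energy_eq`). Hence all the weight is at
one vertex, and what is attached there is a star.

Non-odd-bipartiteness is a parity count around the odd cycle. -/

namespace Hypergraph

/-! ### Forms of set systems, their minimisers and the adjacency tensor. -/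

section Form

variable {I : Type}

/-- The multilinear form `∑ ∏` of a finite set system. -/
def setForm (𝓔 : Finset (Finset I)) (x : I → ℝ) : ℝ := ∑ s ∈ 𝓔, ∏ v ∈ s, x v

open Classical in
/-- The partial derivative of `setForm` in the coordinate `i`. -/
noncomputable def setFormDeriv (𝓔 : Finset (Finset I)) (x : I → ℝ) (i : I) : ℝ :=
  ∑ s ∈ 𝓔 with i ∈ s, ∏ v ∈ s.erase i, x v

theorem setForm_smul {𝓔 : Finset (Finset I)} {k : ℕ} (h𝓔 : ∀ s ∈ 𝓔, s.card = k) (t : ℝ)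
    (x : I → ℝ) : setForm 𝓔 (t • x) = t ^ k * setForm 𝓔 x := by
  unfold setForm
  rw [Finset.mul_sum]
  refine Finset.sum_congr rfl fun s hs => ?_
  simp [Finset.prod_mul_distrib, h𝓔 s hs]

theorem continuous_setForm (𝓔 : Finset (Finset I)) : Continuous (setForm 𝓔) := by
  unfold setForm
  fun_prop

-- Each set contains `i` at most once, so the form is affine in the coordinate `i` with slope
-- `setFormDeriv`.
open Classical in
theorem setForm_update (𝓔 : Finset (Finset I)) (x : I → ℝ) (i : I) (t : ℝ) :
    setForm 𝓔 (Function.update x i t) =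
      t * setFormDeriv 𝓔 x i + ∑ s ∈ 𝓔 with i ∉ s, ∏ v ∈ s, x v := by
  unfold setForm setFormDeriv
  rw [← Finset.sum_filter_add_sum_filter_not 𝓔 (fun s => i ∈ s), Finset.mul_sum]
  congr 1
  · refine Finset.sum_congr rfl fun s hs => ?_
    have hi : i ∈ s := (Finset.mem_filter.1 hs).2
    rw [← Finset.mul_prod_erase s _ hi, Function.update_self]
    congr 1
    exact Finset.prod_congr rfl fun v hv => Function.update_of_ne (Finset.ne_of_mem_erase hv) _ _
  · refine Finset.sum_congr rfl fun s hs => ?_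
    have hi : i ∉ s := (Finset.mem_filter.1 hs).2
    exact Finset.prod_congr rfl fun v hv =>
      Function.update_of_ne (ne_of_mem_of_not_mem hv hi) _ _

variable [Fintype I]

/-- Euler's identity for a form that is homogeneous of degree `k`. -/
theorem sum_mul_setFormDeriv {𝓔 : Finset (Finset I)} {k : ℕ} (h𝓔 : ∀ s ∈ 𝓔, s.card = k)
    (x : I → ℝ) : ∑ i, x i * setFormDeriv 𝓔 x i = k * setForm 𝓔 x := by
  classical
  unfold setForm setFormDeriv
  simp only [Finset.mul_sum, Finset.sum_filter, mul_ite, mul_zero]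
  rw [Finset.sum_comm]
  refine Finset.sum_congr rfl fun s hs => ?_
  rw [← Finset.sum_filter]
  simp only [Finset.filter_mem_eq_inter, Finset.univ_inter]
  rw [Finset.sum_congr rfl fun i hi => Finset.mul_prod_erase s x hi]
  simp [h𝓔 s hs]

theorem sum_pow_pos {k : ℕ} (hk : Even k) {x : I → ℝ} (hx : x ≠ 0) : 0 < ∑ i, x i ^ k := by
  obtain ⟨i, hi⟩ := Function.ne_iff.1 hx
  exact Finset.sum_pos' (fun j _ => hk.pow_nonneg _) ⟨i, Finset.mem_univ _, hk.pow_pos hi⟩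

/-- A minimiser of `k * setForm - c * ∑ x ^ k` satisfies the eigenvalue equations. -/
theorem setFormDeriv_eq_of_isMin {𝓔 : Finset (Finset I)} {k : ℕ} (hk : 0 < k) {c : ℝ} {x : I → ℝ}
    (hmin : ∀ y, 0 ≤ k * setForm 𝓔 y - c * ∑ i, y i ^ k)
    (hx : k * setForm 𝓔 x - c * ∑ i, x i ^ k = 0) (i : I) :
    setFormDeriv 𝓔 x i = c * x i ^ (k - 1) := by
  classical
  set A := ∑ s ∈ 𝓔 with i ∉ s, ∏ v ∈ s, x v
  set B := ∑ j ∈ Finset.univ.erase i, x j ^ k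
  -- The function to be minimised, restricted to the line through `x` in direction `i`; its
  -- derivative at `x i` vanishes.
  let h : ℝ → ℝ := fun t => k * (t * setFormDeriv 𝓔 x i + A) - c * (t ^ k + B)
  have hh : ∀ t, h t = k * setForm 𝓔 (Function.update x i t)
      - c * ∑ j, Function.update x i t j ^ k := by
    intro t
    rw [setForm_update, ← Finset.add_sum_erase _ _ (Finset.mem_univ i), Function.update_self]
    have : ∑ j ∈ Finset.univ.erase i, Function.update x i t j ^ k = B :=
      Finset.sum_congr rfl fun j hj => by
        rw [Function.update_of_ne (Finset.ne_of_mem_erase hj)]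
    rw [this]
  have hloc : IsLocalMin h (x i) := by
    refine Filter.Eventually.of_forall fun t => ?_
    rw [hh, hh, Function.update_eq_self, hx]
    exact hmin _
  have hder : HasDerivAt h (k * (1 * setFormDeriv 𝓔 x i) - c * (k * x i ^ (k - 1))) (x i) := by
    have h1 := (((hasDerivAt_id (x i)).mul_const (setFormDeriv 𝓔 x i)).add_const A).const_mul (k : ℝ)
    have h2 := ((hasDerivAt_pow k (x i)).add_const B).const_mul c
    exact h1.sub h2
  have h0 := hloc.hasDerivAt_eq_zero hder
  have hk' : (k : ℝ) ≠ 0 := by positivity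
  apply mul_left_cancel₀ hk'
  linarith

/-- Both terms are homogeneous of degree `k`, so it suffices to minimise their quotient on the
compact unit sphere, where evenness of `k` keeps the denominator positive. -/
theorem exists_isMin_setForm [Nonempty I] {𝓔 : Finset (Finset I)} {k : ℕ} (hk : Even k)
    (hk0 : 0 < k) (h𝓔 : ∀ s ∈ 𝓔, s.card = k) :
    ∃ (c : ℝ) (x : I → ℝ), x ≠ 0 ∧ (∀ y, 0 ≤ k * setForm 𝓔 y - c * ∑ i, y i ^ k) ∧
      k * setForm 𝓔 x - c * ∑ i, x i ^ k = 0 := by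
  have hS : IsCompact (Metric.sphere (0 : I → ℝ) 1) := isCompact_sphere _ _
  have hne : (Metric.sphere (0 : I → ℝ) 1).Nonempty := ⟨fun _ => 1, by simp⟩
  have hpos : ∀ x ∈ Metric.sphere (0 : I → ℝ) 1, 0 < ∑ i, x i ^ k := fun x hx =>
    sum_pow_pos hk (ne_zero_of_mem_unit_sphere ⟨x, hx⟩)
  have hcont : ContinuousOn (fun x : I → ℝ => k * setForm 𝓔 x / ∑ i, x i ^ k)
      (Metric.sphere (0 : I → ℝ) 1) := by
    refine ContinuousOn.div ?_ ?_ fun x hx => (hpos x hx).ne'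
    · exact ((continuous_setForm 𝓔).const_mul _ |>.continuousOn)
    · fun_prop
  obtain ⟨x, hx, hmin⟩ := hS.exists_isMinOn hne hcont
  refine ⟨k * setForm 𝓔 x / ∑ i, x i ^ k, x, ne_zero_of_mem_unit_sphere ⟨x, hx⟩, fun y => ?_, ?_⟩
  · by_cases hy : y = 0
    · subst hy
      have : setForm 𝓔 (0 : I → ℝ) = 0 := by
        have := setForm_smul h𝓔 0 (0 : I → ℝ)
        simpa [hk0.ne'] using this
      simp [this, hk0.ne']
    · have hn : 0 < ‖y‖ := norm_pos_iff.2 hy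
      set z := ‖y‖⁻¹ • y with hz
      have hzS : z ∈ Metric.sphere (0 : I → ℝ) 1 := by
        simp [hz, norm_smul, hn.ne']
      have hyz : y = ‖y‖ • z := by simp [hz, smul_smul, hn.ne']
      have h1 := hmin hzS
      simp only [Set.mem_ofPred_eq] at h1
      rw [le_div_iff₀ (hpos z hzS)] at h1
      rw [hyz, setForm_smul h𝓔]
      have h2 : ∑ i, (‖y‖ • z) i ^ k = ‖y‖ ^ k * ∑ i, z i ^ k := by
        simp [Finset.mul_sum, mul_pow]
      rw [h2]
      have h3 : 0 ≤ ‖y‖ ^ k := by positivity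
      nlinarith
  · have := (hpos x hx).ne'
    field_simp
    ring

-- Maps from `Fin r` with image `s` are bijections onto `s`. Their number cancels the factor `1 /
-- r!` of the adjacency tensor.
open Classical in
theorem card_image_univ_eq {r : ℕ} {s : Finset I} (hs : s.card = r) :
    (Finset.univ.filter fun t : Fin r → I => Finset.univ.image t = s).card = r.factorial := by
  have hcard : Fintype.card (Fin r) = Fintype.card s := by simp [hs]
  have h1 : Fintype.card (Fin r ≃ s) = r.factorial := by
    rw [Fintype.card_equiv (Fintype.equivOfCardEq hcard)]
    simp
  rw [← h1, ← Finset.card_univ]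
  symm
  refine Finset.card_bij (fun e _ j => (e j : I)) ?_ ?_ ?_
  · intro e _
    simp only [Finset.mem_filter, Finset.mem_univ, true_and]
    ext v
    simp only [Finset.mem_image, Finset.mem_univ, true_and]
    constructor
    · rintro ⟨j, rfl⟩
      exact (e j).2
    · intro hv
      exact ⟨e.symm ⟨v, hv⟩, by simp⟩
  · intro e _ e' _ h
    ext j
    exact congrFun h j
  · intro t ht
    have ht : Finset.univ.image t = s := (Finset.mem_filter.1 ht).2
    have hmem : ∀ j, t j ∈ s := fun j => ht ▸ Finset.mem_image_of_mem _ (Finset.mem_univ _)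
    have hsurj : Function.Surjective fun j => (⟨t j, hmem j⟩ : s) := by
      rintro ⟨v, hv⟩
      rw [← ht] at hv
      obtain ⟨j, -, rfl⟩ := Finset.mem_image.1 hv
      exact ⟨j, rfl⟩
    have hbij := (Fintype.bijective_iff_surjective_and_card _).2 ⟨hsurj, hcard⟩
    exact ⟨Equiv.ofBijective _ hbij, Finset.mem_univ _, rfl⟩

open Classical in
/-- The adjacency tensor of a set system acts as the gradient of its form. -/
theorem tensorApply_setSystem {r : ℕ} {𝓔 : Finset (Finset I)} (h𝓔 : ∀ s ∈ 𝓔, s.card = r + 1)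
    (x : I → ℝ) (i : I) :
    tensorApply (r := r)
      (fun t => if Finset.univ.image t ∈ 𝓔 then 1 / (r.factorial : ℝ) else 0) x i =
      setFormDeriv 𝓔 x i := by
  unfold tensorApply setFormDeriv
  have him : ∀ t : Fin r → I, Finset.univ.image (Fin.cons i t : Fin (r + 1) → I) =
      insert i (Finset.univ.image t) := by
    intro t
    ext v
    simp [Fin.exists_fin_succ, eq_comm]
  simp only [him, ite_mul, zero_mul]
  rw [← Finset.sum_filter]
  have hmaps : ∀ t ∈ Finset.univ.filter (fun t : Fin r → I => insert i (Finset.univ.image t) ∈ 𝓔),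
      insert i (Finset.univ.image t) ∈ 𝓔.filter (fun s => i ∈ s) := by
    intro t ht
    simp only [Finset.mem_filter, Finset.mem_univ, true_and] at ht ⊢
    exact ⟨ht, Finset.mem_insert_self _ _⟩
  rw [← Finset.sum_fiberwise_of_maps_to hmaps]
  refine Finset.sum_congr rfl fun s hs => ?_
  obtain ⟨hs, hi⟩ := Finset.mem_filter.1 hs
  have hcard : (s.erase i).card = r := by rw [Finset.card_erase_of_mem hi, h𝓔 s hs]; rfl
  have hfil : (Finset.univ.filter (fun t : Fin r → I => insert i (Finset.univ.image t) ∈ 𝓔)).filter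
      (fun t => insert i (Finset.univ.image t) = s) =
      Finset.univ.filter fun t : Fin r → I => Finset.univ.image t = s.erase i := by
    ext t
    simp only [Finset.mem_filter, Finset.mem_univ, true_and]
    constructor
    · rintro ⟨-, h⟩
      symm
      apply Finset.eq_of_subset_of_card_le
      · intro v hv
        have := Finset.mem_of_mem_erase hv
        rw [← h] at this
        exact Finset.mem_of_mem_insert_of_ne this (Finset.ne_of_mem_erase hv)
      · rw [hcard]
        exact Finset.card_image_le.trans (by simp)
    · intro h
      rw [h, Finset.insert_erase hi]
      exact ⟨hs, rfl⟩
  rw [hfil]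
  have hprod : ∀ t ∈ Finset.univ.filter (fun t : Fin r → I => Finset.univ.image t = s.erase i),
      1 / (r.factorial : ℝ) * ∏ j, x (t j) =
        1 / (r.factorial : ℝ) * ∏ v ∈ s.erase i, x v := by
    intro t ht
    have ht := (Finset.mem_filter.1 ht).2
    rw [← ht, Finset.prod_image]
    have : Function.Injective t := by
      rw [← Set.injOn_univ, ← Finset.coe_univ, ← Finset.card_image_iff, ht, hcard]
      simp
    exact fun a _ b _ h => this h
  rw [Finset.sum_congr rfl hprod, Finset.sum_const, card_image_univ_eq hcard, nsmul_eq_mul]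
  have : (r.factorial : ℝ) ≠ 0 := by positivity
  field_simp

end Form

/-- The polynomial `∑_{e} ∏_{v ∈ e} x_v` of a hypergraph. -/
noncomputable def form {α : Type} (G : Hypergraph α) (x : α → ℝ) : ℝ :=
  ∑ᶠ e ∈ E(G), ∏ᶠ v ∈ e, x v

/-- `𝒜 x ^ k + μ ∑ x_v ^ k`. -/
noncomputable def energy {α : Type} (G : Hypergraph α) (k : ℕ) (μ : ℝ) (x : α → ℝ) : ℝ :=
  k * G.form x + μ * ∑ᶠ v ∈ V(G), x v ^ k

/-- `c` is the minimum of `𝒜 x ^ k` on `∑ x_v ^ k = 1`. -/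
def IsRayleighMin {α : Type} (k : ℕ) (G : Hypergraph α) (c : ℝ) : Prop :=
  (∀ x, 0 ≤ G.energy k (-c) x) ∧ ∃ x, (∃ v ∈ V(G), x v ≠ 0) ∧ G.energy k (-c) x = 0

/-! ### The least H-eigenvalue as the minimum of the Rayleigh quotient. -/

section Eigenvalue

variable {α : Type} {G : Hypergraph α}

open Classical in
/-- The edges of `G` as finite sets of vertices. -/
noncomputable def edgeFinsets (G : Hypergraph α) [Fintype V(G)] : Finset (Finset V(G)) :=
  Finset.univ.filter fun s => (Subtype.val '' (s : Set V(G))) ∈ E(G)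

theorem mem_edgeFinsets [Fintype V(G)] {s : Finset V(G)} :
    s ∈ G.edgeFinsets ↔ (Subtype.val '' (s : Set V(G))) ∈ E(G) := by
  simp [edgeFinsets]

theorem card_of_mem_edgeFinsets [Fintype V(G)] {k : ℕ} (hG : G.IsUniform k) (s : Finset V(G))
    (hs : s ∈ G.edgeFinsets) : s.card = k := by
  have := hG _ (mem_edgeFinsets.1 hs)
  rw [Subtype.val_injective.encard_image, Set.encard_coe_eq_coe_finsetCard] at this
  exact_mod_cast this

theorem edgeSet_eq_image [Fintype V(G)] :
    E(G) = (fun s : Finset V(G) => Subtype.val '' (s : Set V(G))) '' (G.edgeFinsets : Set _) := by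
  classical
  ext e
  constructor
  · intro he
    refine ⟨Finset.univ.filter fun v => (v : α) ∈ e, ?_, ?_⟩
    · rw [Finset.mem_coe, mem_edgeFinsets]
      convert he
      ext v
      simpa using fun hv => he.subset_vertexSet hv
    · ext v
      simpa using fun hv => he.subset_vertexSet hv
  · rintro ⟨s, hs, rfl⟩
    exact mem_edgeFinsets.1 hs

theorem form_eq_setForm [Fintype V(G)] (x : α → ℝ) :
    G.form x = setForm G.edgeFinsets fun v => x v := by
  unfold form setForm
  rw [edgeSet_eq_image, finsum_mem_image, finsum_mem_coe_finset]
  · refine Finset.sum_congr rfl fun s _ => ?_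
    rw [finprod_mem_image Subtype.val_injective.injOn, finprod_mem_coe_finset]
  · intro s _ t _ h
    exact Finset.coe_injective (Set.image_injective.2 Subtype.val_injective h)

theorem finsum_vertexSet [Fintype V(G)] (f : α → ℝ) : ∑ᶠ v ∈ V(G), f v = ∑ v : V(G), f v := by
  rw [← finsum_eq_sum_of_fintype, finsum_set_coe_eq_finsum_mem]

theorem energy_eq [Fintype V(G)] (k : ℕ) (c : ℝ) (x : α → ℝ) : G.energy k (-c) x =
    k * setForm G.edgeFinsets (fun v => x v) - c * ∑ v : V(G), x v ^ k := by
  rw [energy, form_eq_setForm, finsum_vertexSet]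
  ring

theorem tensorApply_adjTensor [Fintype V(G)] {r : ℕ} (hG : G.IsUniform (r + 1 : ℕ)) (x : V(G) → ℝ)
    (i : V(G)) : tensorApply (G.adjTensor r) x i = setFormDeriv G.edgeFinsets x i := by
  classical
  rw [← tensorApply_setSystem (card_of_mem_edgeFinsets hG)]
  congr 1
  ext t
  unfold adjTensor
  congr 1
  rw [mem_edgeFinsets, eq_iff_iff]
  have : Set.range (fun j => (t j : α)) = Subtype.val '' (Finset.univ.image t : Set V(G)) := by
    ext v
    simp
  rw [this]
  convert Iff.rfl

theorem isRayleighMin_iff [Fintype V(G)] {k : ℕ} {c : ℝ} : IsRayleighMin k G c ↔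
    (∀ y : V(G) → ℝ, 0 ≤ k * setForm G.edgeFinsets y - c * ∑ v, y v ^ k) ∧
      ∃ x : V(G) → ℝ, x ≠ 0 ∧ k * setForm G.edgeFinsets x - c * ∑ v, x v ^ k = 0 := by
  classical
  let ext (y : V(G) → ℝ) : α → ℝ := fun a => if h : a ∈ V(G) then y ⟨a, h⟩ else 0
  have hext : ∀ y, (fun v : V(G) => ext y v) = y := fun y => by ext v; simp [ext]
  have hen : ∀ y, G.energy k (-c) (ext y) =
      k * setForm G.edgeFinsets y - c * ∑ v, y v ^ k := by
    intro y
    rw [energy_eq, hext]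
    congr 2
    exact Finset.sum_congr rfl fun v _ => by rw [← congrFun (hext y) v]
  constructor
  · rintro ⟨h1, x, ⟨v, hv, hx⟩, h2⟩
    refine ⟨fun y => hen y ▸ h1 _, fun v => x v, fun h => hx (congrFun h ⟨v, hv⟩), ?_⟩
    rw [← energy_eq, h2]
  · rintro ⟨h1, x, hx, h2⟩
    refine ⟨fun y => by rw [energy_eq]; exact h1 _, ext x, ?_, by rw [hen, h2]⟩
    obtain ⟨v, hv⟩ := Function.ne_iff.1 hx
    exact ⟨v, v.2, by simpa [ext] using hv⟩

theorem exists_isRayleighMin {k : ℕ} (hk : Even k) (hk0 : 0 < k) (hG : G.IsUniform k)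
    (hV : V(G).Finite) (hne : V(G).Nonempty) : ∃ c, IsRayleighMin k G c := by
  have := hV.fintype
  have := hne.to_subtype
  obtain ⟨c, x, h1, h2, h3⟩ := exists_isMin_setForm hk hk0 (card_of_mem_edgeFinsets hG)
  exact ⟨c, isRayleighMin_iff.2 ⟨h2, x, h1, h3⟩⟩

/-- A minimiser satisfies the eigenvalue equations. Conversely, contracting these equations with the
eigenvector shows that every H-eigenvalue is a value of the Rayleigh quotient. Since a minimum
exists, uniqueness of least elements gives the other implication. -/
theorem isLeastHEigenvalue_iff {k : ℕ} (hk : Even k) (hk0 : 0 < k) (hG : G.IsUniform k)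
    (hV : V(G).Finite) {c : ℝ} : IsLeastHEigenvalue k G c ↔ IsRayleighMin k G c := by
  obtain ⟨r, rfl⟩ : ∃ r, k = r + 1 := ⟨k - 1, by omega⟩
  have hval : ∀ [Fintype V(G)] (l : ℝ) (x : V(G) → ℝ),
      (∀ i, tensorApply (G.adjTensor r) x i = l * x i ^ r) →
      ((r + 1 : ℕ) : ℝ) * setForm G.edgeFinsets x = l * ∑ v, x v ^ (r + 1) := by
    intro _ l x h
    rw [← sum_mul_setFormDeriv (card_of_mem_edgeFinsets hG), Finset.mul_sum]
    refine Finset.sum_congr rfl fun i _ => ?_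
    rw [← tensorApply_adjTensor hG, h]
    ring
  have key : ∀ [Fintype V(G)] (c : ℝ), IsRayleighMin (r + 1) G c →
      IsLeast {l : ℝ | IsHEigenvalue (G.adjTensor r) l} c := by
    intro _ c hc
    obtain ⟨h1, x, hx, h2⟩ := isRayleighMin_iff.1 hc
    refine ⟨⟨x, hx, fun i => ?_⟩, ?_⟩
    · rw [tensorApply_adjTensor hG]
      exact setFormDeriv_eq_of_isMin hk0 h1 h2 i
    · rintro l ⟨y, hy, hl⟩
      have h3 := h1 y
      rw [hval l y hl, ← sub_mul] at h3
      have := nonneg_of_mul_nonneg_left h3 (sum_pow_pos hk hy)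
      linarith
  constructor
  · rintro ⟨_, hc⟩
    obtain ⟨x, hx, -⟩ := hc.1
    obtain ⟨v, -⟩ := Function.ne_iff.1 hx
    obtain ⟨c', hc'⟩ := exists_isRayleighMin hk hk0 hG hV ⟨v, v.2⟩
    rwa [hc.unique (key c' hc')]
  · intro hc
    exact ⟨hV.fintype, @key hV.fintype c hc⟩

end Eigenvalue

/-! ### Rooting a hypertree. -/

section Hypertree

variable {α : Type}

/-- The simple graph joining distinct vertices that lie in a common member of `S`. -/
def linkGraph (S : Set (Set α)) : SimpleGraph α where
  Adj a b := a ≠ b ∧ ∃ e ∈ S, a ∈ e ∧ b ∈ e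
  symm := ⟨fun _ _ h => ⟨h.1.symm, h.2.imp fun _ he => ⟨he.1, he.2.2, he.2.1⟩⟩⟩
  loopless := ⟨fun _ h => h.1 rfl⟩

theorem linkGraph_mono {S S' : Set (Set α)} (h : S ⊆ S') : linkGraph S ≤ linkGraph S' :=
  fun _ _ hab => ⟨hab.1, hab.2.imp fun _ he => ⟨h he.1, he.2⟩⟩

theorem linkGraph_reachable {S : Set (Set α)} {e : Set α} (he : e ∈ S) {a b : α} (ha : a ∈ e)
    (hb : b ∈ e) : (linkGraph S).Reachable a b := by
  by_cases h : a = b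
  · rw [h]
  · exact SimpleGraph.Adj.reachable ⟨h, e, he, ha, hb⟩

/-- Two vertices of an edge `e` that are linked through other edges give a Berge cycle. -/
theorem not_isAcyclic_of_reachable {T : Hypergraph α} {S : Set (Set α)} (hS : S ⊆ E(T))
    {e : Set α} (he : e ∈ E(T)) (heS : e ∉ S) {a b : α} (ha : a ∈ e) (hb : b ∈ e) (hab : a ≠ b)
    (hr : (linkGraph S).Reachable a b) : ¬ T.IsAcyclic := by
  -- A shortest walk has distinct vertices, since they lie at distinct distances from `a`.
  obtain ⟨w, hw⟩ := hr.exists_walk_length_eq_dist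
  have hdist : ∀ i ≤ w.length, (linkGraph S).dist a (w.getVert i) = i := by
    intro i hi
    rw [← SimpleGraph.length_eq_dist_of_subwalk hw (w.isSubwalk_take i),
      SimpleGraph.Walk.take_length, min_eq_left hi]
  have hstep : ∀ i, ∃ f, i < w.length → f ∈ S ∧ w.getVert i ∈ f ∧ w.getVert (i + 1) ∈ f := by
    intro i
    by_cases hi : i < w.length
    · obtain ⟨-, f, hf⟩ := w.adj_getVert_succ hi
      exact ⟨f, fun _ => hf⟩
    · exact ⟨∅, fun h => absurd h hi⟩
  choose f hf using hstep
  -- An edge used twice would allow a shortcut in the shortest walk, so the edges are distinct as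
  -- well.
  have hfne : ∀ i j, i < j → j < w.length → f i ≠ f j := by
    intro i j hij hj h
    have h1 := (hf i (hij.trans hj)).2.1
    have h2 := (hf j hj).2.2
    have h3 := hdist i (hij.trans hj).le
    have h4 := hdist (j + 1) hj
    obtain ⟨p, hp⟩ := (w.take i).reachable.exists_walk_length_eq_dist
    by_cases heq : w.getVert i = w.getVert (j + 1)
    · rw [heq, h4] at h3
      omega
    · have hadj : (linkGraph S).Adj (w.getVert i) (w.getVert (j + 1)) :=
        ⟨heq, f j, (hf j hj).1, h ▸ h1, h2⟩
      have h5 := SimpleGraph.dist_le (p.concat hadj)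
      rw [SimpleGraph.Walk.length_concat, hp, h3, h4] at h5
      omega
  obtain ⟨l, hl⟩ : ∃ l, w.length = l + 1 := by
    refine Nat.exists_eq_succ_of_ne_zero fun h => hab ?_
    exact SimpleGraph.Walk.eq_of_length_eq_zero h
  -- The last index, equal to the length of the walk, is given to `e`, which closes the cycle from
  -- `b` back to `a`.
  refine fun hac => hac ⟨l, fun i => w.getVert i,
    fun i => if (i : ℕ) < w.length then f i else e, ?_, ?_, ?_⟩
  · intro i j hij
    have h1 := hdist i (by omega)
    have h2 := hdist j (by omega)
    simp only at hij
    rw [hij, h2] at h1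
    exact Fin.ext h1.symm
  · intro i j hij
    simp only at hij
    split_ifs at hij with h1 h2 h2
    · rcases lt_trichotomy (i : ℕ) j with h | h | h
      · exact absurd hij (hfne _ _ h h2)
      · exact Fin.ext h
      · exact absurd hij.symm (hfne _ _ h h1)
    · exact absurd (hij ▸ (hf i h1).1) heS
    · exact absurd (hij ▸ (hf j h2).1) heS
    · apply Fin.ext
      omega
  · intro i
    simp only
    split_ifs with h
    · refine ⟨hS (hf i h).1, (hf i h).2.1, ?_⟩
      have : ((i + 1 : Fin (l + 2)) : ℕ) = i + 1 := by
        rw [Fin.val_add_one, if_neg]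
        intro hlast
        rw [hlast, Fin.val_last] at h
        omega
      rw [this]
      exact (hf i h).2.2
    · have hi : i = Fin.last (l + 1) := by
        apply Fin.ext
        rw [Fin.val_last]
        omega
      subst hi
      refine ⟨he, ?_, ?_⟩
      · rw [Fin.val_last, ← hl, SimpleGraph.Walk.getVert_length]
        exact hb
      · simpa using ha

/-- `p` sends each edge to the end closest to the root `w`: every other vertex of the hypergraph
is, in exactly one way, a member of an edge other than the end chosen by `p`. -/
structure IsParentMap (T : Hypergraph α) (w : α) (p : Set α → α) : Prop where
  mem : ∀ e ∈ E(T), p e ∈ e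
  disjoint : E(T).PairwiseDisjoint fun e => e \ {p e}
  iUnion : ⋃ e ∈ E(T), e \ {p e} = V(T) \ {w}

/-- `p` is a parent map on the set `S` of edges, which is linked to `w`. -/
structure IsExplored (T : Hypergraph α) (w : α) (S : Set (Set α)) (p : Set α → α) : Prop where
  subset : S ⊆ E(T)
  mem : ∀ e ∈ S, p e ∈ e
  disjoint : S.PairwiseDisjoint fun e => e \ {p e}
  notMem : ∀ e ∈ S, w ∉ e \ {p e}
  parent : ∀ e ∈ S, p e ∈ insert w (⋃ f ∈ S, f \ {p f})
  reachable : ∀ e ∈ S, ∀ v ∈ e, (linkGraph S).Reachable w v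

/-- A new edge meets the explored part only in `q`: a second common vertex would be linked to `q`
through `S`, and together with `e` this would give a Berge cycle. So `q` can serve as the parent and
all other vertices of `e` are new. -/
theorem IsExplored.insert {T : Hypergraph α} {w : α} {S : Set (Set α)} {p : Set α → α}
    (h : T.IsExplored w S p) (hT : T.IsAcyclic) {e : Set α} (he : e ∈ E(T)) (heS : e ∉ S) {q : α}
    (hqe : q ∈ e) (hq : q ∈ Insert.insert w (⋃₀ S)) :
    ∃ p', T.IsExplored w (Insert.insert e S) p' := by
  classical
  have hreach : ∀ v ∈ Insert.insert w (⋃₀ S), (linkGraph S).Reachable w v := by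
    rintro v (rfl | ⟨f, hf, hv⟩)
    · rfl
    · exact h.reachable f hf v hv
  have huniq : ∀ v ∈ e, v ∈ Insert.insert w (⋃₀ S) → v = q := by
    intro v hve hv
    by_contra hne
    exact not_isAcyclic_of_reachable h.subset he heS hve hqe hne
      ((hreach v hv).symm.trans (hreach q hq)) hT
  have hp' : ∀ f ∈ S, Function.update p e q f = p f := fun f hf =>
    Function.update_of_ne (ne_of_mem_of_not_mem hf heS) _ _
  have hdis : ∀ f ∈ S, Disjoint (e \ {q}) (f \ {p f}) := by
    intro f hf
    rw [Set.disjoint_left]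
    rintro v ⟨hve, hvq⟩ ⟨hvf, -⟩
    exact hvq (huniq v hve (Or.inr ⟨f, hf, hvf⟩))
  have hsub : Insert.insert w (⋃ f ∈ S, f \ {p f}) ⊆
      Insert.insert w (⋃ f ∈ Insert.insert e S, f \ {Function.update p e q f}) := by
    apply Set.insert_subset_insert
    intro v hv
    simp only [Set.mem_iUnion] at hv ⊢
    obtain ⟨f, hf, hv⟩ := hv
    exact ⟨f, Or.inr hf, by rwa [hp' f hf]⟩
  have hcov : Insert.insert w (⋃₀ S) ⊆ Insert.insert w (⋃ f ∈ S, f \ {p f}) := by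
    rintro v (rfl | ⟨f, hf, hv⟩)
    · exact Or.inl rfl
    · by_cases hvp : v = p f
      · exact hvp ▸ h.parent f hf
      · right
        simp only [Set.mem_iUnion]
        exact ⟨f, hf, hv, hvp⟩
  refine ⟨Function.update p e q, Set.insert_subset he h.subset, ?_, ?_, ?_, ?_, ?_⟩
  · rintro f (rfl | hf)
    · rwa [Function.update_self]
    · rw [hp' f hf]
      exact h.mem f hf
  · refine (Set.pairwiseDisjoint_insert_of_notMem heS).2 ⟨?_, ?_⟩
    · intro f hf g hg hfg
      simp only [Function.onFun, hp' f hf, hp' g hg]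
      exact h.disjoint hf hg hfg
    · intro f hf
      simp only [hp' f hf, Function.update_self]
      exact hdis f hf
  · rintro f (rfl | hf)
    · rw [Function.update_self]
      rintro ⟨hw, hwq⟩
      exact hwq (huniq w hw (Or.inl rfl))
    · rw [hp' f hf]
      exact h.notMem f hf
  · rintro f (rfl | hf)
    · rw [Function.update_self]
      exact hsub (hcov hq)
    · rw [hp' f hf]
      exact hsub (h.parent f hf)
  · have hmono : linkGraph S ≤ linkGraph (Insert.insert e S) :=
      linkGraph_mono (Set.subset_insert _ _)
    rintro f (rfl | hf) v hv
    · exact ((hreach q hq).mono hmono).trans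
        (linkGraph_reachable (Set.mem_insert _ _) hqe hv)
    · exact (h.reachable f hf v hv).mono hmono

/-- A finite hypertree can be rooted at any of its vertices. -/
theorem IsHypertree.exists_isParentMap {T : Hypergraph α} (hT : T.IsHypertree)
    (hne : ∀ e ∈ E(T), e.Nonempty) {w : α} (hw : w ∈ V(T)) : ∃ p, T.IsParentMap w p := by
  obtain ⟨hfin, ⟨-, hconn⟩, hac⟩ := hT
  have hE : E(T).Finite := hfin.finite_subsets.subset fun e he => he.subset_vertexSet
  have hfam : {S | ∃ p, T.IsExplored w S p}.Finite :=
    hE.finite_subsets.subset fun S ⟨p, hp⟩ => hp.subset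
  -- For a maximal explored set, no further edge touches the explored vertices; by connectivity it
  -- then consists of all edges.
  obtain ⟨S, ⟨p, hp⟩, hmax⟩ := hfam.exists_maximal
    ⟨∅, fun _ => w, by constructor <;> simp⟩
  have hgrow : ∀ e ∈ E(T), e ∉ S → ∀ q ∈ e, q ∉ insert w (⋃₀ S) := by
    intro e he heS q hqe hq
    exact heS (hmax (hp.insert hac he heS hqe hq) (Set.subset_insert _ _) (Set.mem_insert _ _))
  have hclosed : ∀ v ∈ V(T), v ∈ insert w (⋃₀ S) := by
    intro v hv
    induction hconn w hw v hv with
    | refl => exact Or.inl rfl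
    | tail _ hadj ih =>
      obtain ⟨e, he, hb, hc⟩ := hadj
      have hb' := ih (he.subset_vertexSet hb)
      by_cases heS : e ∈ S
      · exact Or.inr ⟨e, heS, hc⟩
      · exact absurd hb' (hgrow e he heS _ hb)
  have hSE : S = E(T) := by
    refine hp.subset.antisymm fun e he => ?_
    by_contra heS
    obtain ⟨q, hq⟩ := hne e he
    exact hgrow e he heS q hq (hclosed q (he.subset_vertexSet hq))
  subst hSE
  refine ⟨p, hp.mem, hp.disjoint, ?_⟩
  ext v
  simp only [Set.mem_iUnion]
  constructor
  · rintro ⟨e, he, hv⟩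
    refine ⟨he.subset_vertexSet hv.1, ?_⟩
    rintro rfl
    exact hp.notMem e he hv
  · rintro ⟨hv, hvw⟩
    obtain rfl | ⟨e, he, hve⟩ := hclosed v hv
    · exact absurd rfl hvw
    · by_cases hvp : v = p e
      · obtain h | h := hvp ▸ hp.parent e he
        · exact absurd h hvw
        · simpa only [Set.mem_iUnion, exists_prop] using h
      · exact ⟨e, he, hve, hvp⟩

end Hypertree

/-! ### The inequality of arithmetic and geometric means on one edge. -/

/-- The means inequality for the numbers `a i ^ k` with equal weights `1 / k`, together with its
case of equality. -/
theorem mul_prod_le_sum_pow {I : Type} {s : Finset I} {k : ℕ} (hk : 0 < k) (hs : s.card = k)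
    {a : I → ℝ} (ha : ∀ i, 0 ≤ a i) :
    k * ∏ i ∈ s, a i ≤ ∑ i ∈ s, a i ^ k ∧
      (k * ∏ i ∈ s, a i = ∑ i ∈ s, a i ^ k → ∀ i ∈ s, ∀ j ∈ s, a i = a j) := by
  have hk' : (0 : ℝ) < k := by exact_mod_cast hk
  have hw : ∀ i ∈ s, (0 : ℝ) < (k : ℝ)⁻¹ := fun _ _ => by positivity
  have hw1 : ∑ _i ∈ s, (k : ℝ)⁻¹ = 1 := by
    rw [Finset.sum_const, hs, nsmul_eq_mul, mul_inv_cancel₀ hk'.ne']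
  have hz : ∀ i ∈ s, 0 ≤ a i ^ k := fun i _ => pow_nonneg (ha i) k
  have hg : ∏ i ∈ s, (a i ^ k) ^ ((k : ℝ)⁻¹) = ∏ i ∈ s, a i :=
    Finset.prod_congr rfl fun i _ => Real.pow_rpow_inv_natCast (ha i) hk.ne'
  have hle := Real.geom_mean_le_arith_mean_weighted s (fun _ => (k : ℝ)⁻¹) (fun i => a i ^ k)
    (fun i hi => (hw i hi).le) hw1 hz
  have heq := Real.geom_mean_eq_arith_mean_weighted_iff_of_pos s (fun _ => (k : ℝ)⁻¹)
    (fun i => a i ^ k) hw hw1 hz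
  rw [hg, ← Finset.mul_sum] at hle heq
  rw [inv_mul_eq_div, le_div_iff₀ hk', mul_comm] at hle
  refine ⟨hle, fun h i hi j hj => ?_⟩
  have := heq.1 (by rw [← h]; field_simp) i hi j hj
  exact (pow_left_inj₀ (ha i) (ha j) hk.ne').1 this

/-- The defect in the weighted inequality of arithmetic and geometric means on an edge `e` with a
distinguished vertex `p`. -/
noncomputable def edgeGap {α : Type} (k : ℕ) (μ : ℝ) (x : α → ℝ) (e : Set α) (p : α) : ℝ :=
  k * ∏ᶠ v ∈ e, x v + μ * ∑ᶠ v ∈ e \ {p}, x v ^ k + (μ ^ (k - 1))⁻¹ * x p ^ k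

/-- Apply the means inequality to `|x p|` and the numbers `μ * |x v|` for `v ≠ p`, then divide by `μ
^ (k - 1)`. -/
theorem edgeGap_nonneg_and {α : Type} {k : ℕ} (hk : Even k) (hk0 : 0 < k) {μ : ℝ} (hμ : 0 < μ)
    (x : α → ℝ) {e : Set α} (he : e.encard = k) {p : α} (hp : p ∈ e) :
    0 ≤ edgeGap k μ x e p ∧
      (edgeGap k μ x e p = 0 → ∀ v ∈ e \ {p}, μ * |x v| = |x p|) := by
  classical
  have hfin : e.Finite := Set.finite_of_encard_eq_coe he
  lift e to Finset α using hfin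
  rw [Set.encard_coe_eq_coe_finsetCard] at he
  have he : e.card = k := by exact_mod_cast he
  have hp : p ∈ e := hp
  let a : α → ℝ := fun v => if v = p then |x v| else μ * |x v|
  have ha : ∀ v, 0 ≤ a v := fun v => by
    simp only [a]
    split_ifs <;> positivity
  have hap : a p = |x p| := if_pos rfl
  have hav : ∀ v ∈ e.erase p, a v = μ * |x v| := fun v hv => if_neg (Finset.ne_of_mem_erase hv)
  have hcard : (e.erase p).card = k - 1 := by rw [Finset.card_erase_of_mem hp, he]
  have hprod : ∏ v ∈ e, a v = μ ^ (k - 1) * |∏ v ∈ e, x v| := by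
    rw [← Finset.mul_prod_erase e a hp, hap, Finset.prod_congr rfl hav, Finset.prod_mul_distrib,
      Finset.prod_const, hcard, ← Finset.mul_prod_erase e x hp, abs_mul, Finset.abs_prod]
    ring
  have hsum : ∑ v ∈ e, a v ^ k = x p ^ k + μ ^ k * ∑ v ∈ e.erase p, x v ^ k := by
    rw [← Finset.add_sum_erase e _ hp, hap, hk.pow_abs, Finset.mul_sum]
    congr 1
    refine Finset.sum_congr rfl fun v hv => ?_
    rw [hav v hv, mul_pow, hk.pow_abs]
  obtain ⟨h1, h2⟩ := mul_prod_le_sum_pow hk0 he ha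
  rw [hprod, hsum] at h1 h2
  have hgap : μ ^ (k - 1) * edgeGap k μ x e p =
      μ ^ (k - 1) * (k * ∏ v ∈ e, x v) + μ ^ k * ∑ v ∈ e.erase p, x v ^ k + x p ^ k := by
    have hm : μ ^ k = μ ^ (k - 1) * μ := (pow_sub_one_mul hk0.ne' μ).symm
    have hm0 : μ ^ (k - 1) ≠ 0 := by positivity
    rw [edgeGap, finprod_mem_coe_finset, ← Finset.coe_singleton, ← Finset.coe_sdiff,
      finsum_mem_coe_finset, Finset.sdiff_singleton_eq_erase, hm]
    field_simp
  have hm : 0 < μ ^ (k - 1) := by positivity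
  have habs : -(μ ^ (k - 1) * (k * ∏ v ∈ e, x v)) ≤ k * (μ ^ (k - 1) * |∏ v ∈ e, x v|) := by
    have h3 := neg_abs_le (∏ v ∈ e, x v)
    have h4 : 0 ≤ μ ^ (k - 1) * k := by positivity
    nlinarith
  constructor
  · refine nonneg_of_mul_nonneg_right (a := μ ^ (k - 1)) ?_ hm
    rw [hgap]
    linarith
  · intro h0 v hv
    rw [h0, mul_zero] at hgap
    have hv : v ∈ e.erase p := Finset.mem_erase.2 ⟨hv.2, hv.1⟩
    rw [← hav v hv, ← hap]
    exact h2 (by linarith) v (Finset.mem_of_mem_erase hv) p hp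

/-! ### Lower bound for the energy of an attached hypertree. -/

section Branch

variable {α : Type} {T : Hypergraph α}

/-- The contribution of a branch with root `r` to the energy; the root itself is not counted. -/
noncomputable def branchEnergy (T : Hypergraph α) (r : α) (k : ℕ) (μ : ℝ) (x : α → ℝ) : ℝ :=
  k * T.form x + μ * ∑ᶠ v ∈ V(T) \ {r}, x v ^ k

/-- `T` is a star with centre `r` and leaf sets `D`. -/
structure IsStarAt (T : Hypergraph α) (k : ℕ) (r : α) (D : Set (Set α)) : Prop where
  disjoint : D.PairwiseDisjoint id
  encard : ∀ d ∈ D, d.encard = (k - 1 : ℕ)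
  notMem : ∀ d ∈ D, r ∉ d
  vertexSet : V(T) = insert r (⋃₀ D)
  edgeSet : E(T) = insert r '' D

theorem finite_edgeSet (hV : V(T).Finite) : E(T).Finite :=
  hV.finite_subsets.subset fun _ he => he.subset_vertexSet

/-- Once the root is counted, both sides are the full energy of `T`. This allows the root to be
moved. -/
theorem branchEnergy_add (hV : V(T).Finite) {r w : α} (hr : r ∈ V(T)) (hw : w ∈ V(T)) (k : ℕ)
    (μ : ℝ) (x : α → ℝ) :
    T.branchEnergy r k μ x + μ * x r ^ k = T.branchEnergy w k μ x + μ * x w ^ k := by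
  have h : ∀ v ∈ V(T), ∑ᶠ a ∈ V(T), x a ^ k = ∑ᶠ a ∈ V(T) \ {v}, x a ^ k + x v ^ k := by
    intro v hv
    conv_lhs => rw [← Set.insert_eq_of_mem hv, ← Set.insert_sdiff_singleton,
      finsum_mem_insert _ (by simp) hV.sdiff, add_comm]
  have := (h r hr).symm.trans (h w hw)
  unfold branchEnergy
  linear_combination μ * this

/-- The sets `e \ {p e}` partition the vertices other than `w`, so the power sum splits over the
edges. The second summand on the right records the cost of charging each edge to the root instead of
to its parent vertex. -/
theorem IsParentMap.branchEnergy_eq {w : α} {p : Set α → α} (hp : T.IsParentMap w p)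
    (hV : V(T).Finite) (k : ℕ) (μ : ℝ) (x : α → ℝ) :
    T.branchEnergy w k μ x + T.edgeSet.ncard * ((μ ^ (k - 1))⁻¹ * x w ^ k) =
      ∑ᶠ e ∈ E(T), (edgeGap k μ x e (p e) + (μ ^ (k - 1))⁻¹ * (x w ^ k - x (p e) ^ k)) := by
  have hE := finite_edgeSet hV
  have hsum : ∑ᶠ v ∈ V(T) \ {w}, x v ^ k = ∑ᶠ e ∈ E(T), ∑ᶠ v ∈ e \ {p e}, x v ^ k := by
    rw [← hp.iUnion]
    exact finsum_mem_biUnion hp.disjoint hE fun e he => (hV.subset he.subset_vertexSet).sdiff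
  rw [branchEnergy, form, hsum]
  simp only [finsum_mem_eq_finite_toFinset_sum _ hE, Set.ncard_eq_toFinset_card _ hE]
  rw [Finset.mul_sum, Finset.mul_sum, ← Finset.sum_add_distrib, ← nsmul_eq_mul,
    ← Finset.sum_const, ← Finset.sum_add_distrib]
  refine Finset.sum_congr rfl fun e _ => ?_
  unfold edgeGap
  ring

theorem pow_le_pow_of_abs_le {k : ℕ} (hk : Even k) {a b : ℝ} (h : |a| ≤ |b|) : a ^ k ≤ b ^ k := by
  rw [← hk.pow_abs a, ← hk.pow_abs b]
  exact pow_le_pow_left₀ (abs_nonneg _) h k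

theorem abs_eq_of_pow_eq {k : ℕ} (hk : Even k) (hk0 : 0 < k) {a b : ℝ} (h : a ^ k = b ^ k) :
    |a| = |b| := by
  rw [← hk.pow_abs a, ← hk.pow_abs b] at h
  exact (pow_left_inj₀ (abs_nonneg _) (abs_nonneg _) hk0.ne').1 h

/-- The bound for a branch rooted at a vertex of largest absolute value. -/
theorem IsParentMap.branchEnergy_bound {w : α} {p : Set α → α} (hp : T.IsParentMap w p) {k : ℕ}
    (hk : Even k) (hk0 : 0 < k) (hT : T.IsUniform k) (hV : V(T).Finite) {μ : ℝ} (hμ : 0 < μ)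
    {x : α → ℝ} (hx : ∀ v ∈ V(T), |x v| ≤ |x w|) :
    0 ≤ T.branchEnergy w k μ x + T.edgeSet.ncard * ((μ ^ (k - 1))⁻¹ * x w ^ k) ∧
      (T.branchEnergy w k μ x + T.edgeSet.ncard * ((μ ^ (k - 1))⁻¹ * x w ^ k) = 0 →
        ∀ e ∈ E(T), |x (p e)| = |x w| ∧ ∀ v ∈ e \ {p e}, μ * |x v| = |x w|) := by
  have hE := finite_edgeSet hV
  have hq : 0 < (μ ^ (k - 1))⁻¹ := by positivity
  have h1 : ∀ e ∈ E(T), 0 ≤ x w ^ k - x (p e) ^ k := fun e he =>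
    sub_nonneg.2 (pow_le_pow_of_abs_le hk (hx _ (he.subset_vertexSet (hp.mem e he))))
  have h2 := fun e (he : e ∈ E(T)) => edgeGap_nonneg_and hk hk0 hμ x (hT e he) (hp.mem e he)
  have h3 : ∀ e ∈ hE.toFinset,
      0 ≤ edgeGap k μ x e (p e) + (μ ^ (k - 1))⁻¹ * (x w ^ k - x (p e) ^ k) := by
    intro e he
    rw [Set.Finite.mem_toFinset] at he
    exact add_nonneg (h2 e he).1 (mul_nonneg hq.le (h1 e he))
  rw [hp.branchEnergy_eq hV, finsum_mem_eq_finite_toFinset_sum _ hE]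
  refine ⟨Finset.sum_nonneg h3, fun h0 e he => ?_⟩
  have h4 := (Finset.sum_eq_zero_iff_of_nonneg h3).1 h0 e (hE.mem_toFinset.2 he)
  have h5 := (h2 e he).1
  have h6 := mul_nonneg hq.le (h1 e he)
  have h7 : x w ^ k - x (p e) ^ k = 0 := by
    have : (μ ^ (k - 1))⁻¹ * (x w ^ k - x (p e) ^ k) = 0 := by linarith
    exact (mul_eq_zero.1 this).resolve_left hq.ne'
  have h8 : |x (p e)| = |x w| := abs_eq_of_pow_eq hk hk0 (by linarith)
  exact ⟨h8, h8 ▸ (h2 e he).2 (by linarith)⟩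

/-- A hypertree with `m` edges that is attached at its vertex `r` lowers the energy at most as much
as a star with `m` edges does, provided that `m ≤ μ ^ k`. If `m < μ ^ k`, then equality holds only
if the vector vanishes on the hypertree or the hypertree is a star. -/
theorem IsHypertree.branchEnergy_bound {k : ℕ} (hk : Even k) (hk0 : 0 < k) (hT : T.IsUniform k)
    (hH : T.IsHypertree) {r : α} (hr : r ∈ V(T)) {μ : ℝ} (hμ : 0 < μ)
    (hm : (E(T).ncard : ℝ) ≤ μ ^ k) (x : α → ℝ) :
    -(E(T).ncard * ((μ ^ (k - 1))⁻¹ * x r ^ k)) ≤ T.branchEnergy r k μ x ∧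
      (-(E(T).ncard * ((μ ^ (k - 1))⁻¹ * x r ^ k)) = T.branchEnergy r k μ x →
        (E(T).ncard : ℝ) < μ ^ k →
          (x r = 0 → ∀ v ∈ V(T), x v = 0) ∧ (x r ≠ 0 → ∃ D, T.IsStarAt k r D)) := by
  have hV := hH.1
  have hne : ∀ e ∈ E(T), e.Nonempty := fun e he => by
    rw [← Set.encard_pos, hT e he]
    exact_mod_cast hk0
  -- Rooting at a vertex of largest absolute value makes every charge to the root favourable.
  obtain ⟨w, hw, hmax⟩ := Set.exists_max_image V(T) (fun v => |x v|) hV ⟨r, hr⟩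
  obtain ⟨p, hp⟩ := hH.exists_isParentMap hne hw
  obtain ⟨h1, -⟩ := hp.branchEnergy_bound hk hk0 hT hV hμ hmax
  have h2 := branchEnergy_add hV hr hw k μ x
  have h3 : x r ^ k ≤ x w ^ k := pow_le_pow_of_abs_le hk (hmax r hr)
  have hm0 : 0 < μ ^ (k - 1) := by positivity
  have hμk : μ ^ k = μ ^ (k - 1) * μ := (pow_sub_one_mul hk0.ne' μ).symm
  -- Returning from the root `w` to `r` leaves the surplus `(μ - m q) (x w ^ k - x r ^ k)` with `m =
  -- E(T).ncard` and `q = (μ ^ (k - 1))⁻¹`; its first factor has the sign of `μ ^ k - m`.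
  have hμm : μ - E(T).ncard * (μ ^ (k - 1))⁻¹ = (μ ^ k - E(T).ncard) * (μ ^ (k - 1))⁻¹ := by
    rw [hμk]
    field_simp
  have h4 : 0 ≤ μ - E(T).ncard * (μ ^ (k - 1))⁻¹ := by
    rw [hμm]
    exact mul_nonneg (by linarith) (by positivity)
  have h5 := mul_nonneg h4 (sub_nonneg.2 h3)
  refine ⟨by linarith, fun heq hlt => ?_⟩
  have h6 : 0 < μ - E(T).ncard * (μ ^ (k - 1))⁻¹ := by
    rw [hμm]
    exact mul_pos (by linarith) (by positivity)
  have h7 : |x w| = |x r| := by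
    have : (μ - E(T).ncard * (μ ^ (k - 1))⁻¹) * (x w ^ k - x r ^ k) = 0 := by linarith
    have := (mul_eq_zero.1 this).resolve_left h6.ne'
    exact abs_eq_of_pow_eq hk hk0 (by linarith)
  have hmax' : ∀ v ∈ V(T), |x v| ≤ |x r| := fun v hv => h7 ▸ hmax v hv
  refine ⟨fun hr0 v hv => ?_, fun hr0 => ?_⟩
  · have := hmax' v hv
    rwa [hr0, abs_zero, abs_nonpos_iff] at this
  · obtain ⟨p, hp⟩ := hH.exists_isParentMap hne hr
    have h8 := (hp.branchEnergy_bound hk hk0 hT hV hμ hmax').2 (by linarith)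
    -- If `p e ≠ r`, then `p e` is a non-parent vertex of some edge `f`. Equality on `e` gives `|x
    -- (p e)| = |x r|` and equality on `f` gives `μ * |x (p e)| = |x r|`. So `μ = 1`, contradicting
    -- `1 ≤ E(T).ncard < μ ^ k`.
    have hpr : ∀ e ∈ E(T), p e = r := by
      intro e he
      by_contra hpe
      have hcov : p e ∈ V(T) \ {r} := ⟨he.subset_vertexSet (hp.mem e he), hpe⟩
      rw [← hp.iUnion] at hcov
      simp only [Set.mem_iUnion] at hcov
      obtain ⟨f, hf, hmem⟩ := hcov
      have h9 := (h8 f hf).2 _ hmem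
      rw [(h8 e he).1] at h9
      have hμ1 : μ = 1 := by
        have : |x r| ≠ 0 := abs_ne_zero.2 hr0
        exact mul_right_cancel₀ this (by rw [h9, one_mul])
      have hcard : 1 ≤ E(T).ncard :=
        Nat.one_le_iff_ne_zero.2 (Set.ncard_ne_zero_of_mem he (finite_edgeSet hV))
      have : (1 : ℝ) ≤ E(T).ncard := by exact_mod_cast hcard
      rw [hμ1, one_pow] at hlt
      linarith
    have hmem : ∀ e ∈ E(T), r ∈ e := fun e he => hpr e he ▸ hp.mem e he
    refine ⟨(fun e => e \ {r}) '' E(T), ?_, ?_, ?_, ?_, ?_⟩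
    · rintro _ ⟨e, he, rfl⟩ _ ⟨f, hf, rfl⟩ hef
      have := hp.disjoint he hf fun h => hef (by rw [h])
      rw [Function.onFun, hpr e he, hpr f hf] at this
      exact this
    · rintro _ ⟨e, he, rfl⟩
      rw [Set.encard_sdiff_singleton_of_mem (hmem e he), hT e he]
      norm_cast
    · rintro _ ⟨e, he, rfl⟩
      simp
    · have h9 : ⋃₀ ((fun e => e \ {r}) '' E(T)) = V(T) \ {r} := by
        rw [← hp.iUnion, Set.sUnion_image]
        exact Set.iUnion₂_congr fun e he => by rw [hpr e he]
      rw [h9, Set.insert_sdiff_singleton, Set.insert_eq_of_mem hr]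
    · rw [Set.image_image]
      ext e
      constructor
      · intro he
        exact ⟨e, he, by simp [Set.insert_eq_of_mem (hmem e he)]⟩
      · rintro ⟨f, hf, rfl⟩
        simpa [Set.insert_eq_of_mem (hmem f hf)] using hf

end Branch

/-! ### Invariance under isomorphism. -/

section Image

variable {α β γ : Type} {G : Hypergraph α}

theorem injOn_image_edgeSet {f : α → β} (hf : Set.InjOn f V(G)) :
    Set.InjOn (Set.image f) E(G) := fun _ he _ he' h =>
  (hf.image_eq_image_iff he.subset_vertexSet he'.subset_vertexSet).1 h

theorem form_image {f : α → β} (hf : Set.InjOn f V(G)) (x : β → ℝ) :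
    (G.image f).form x = G.form (x ∘ f) := by
  unfold form
  rw [image_edgeSet, finsum_mem_image (injOn_image_edgeSet hf)]
  exact finsum_mem_congr rfl fun e he => finprod_mem_image (hf.mono he.subset_vertexSet)

theorem energy_image {f : α → β} (hf : Set.InjOn f V(G)) (k : ℕ) (μ : ℝ) (x : β → ℝ) :
    (G.image f).energy k μ x = G.energy k μ (x ∘ f) := by
  unfold energy
  rw [form_image hf, image_vertexSet, finsum_mem_image hf]
  rfl

theorem IsUniform.image {k : ℕ} (hG : G.IsUniform k) {f : α → β} (hf : Set.InjOn f V(G)) :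
    (G.image f).IsUniform k := by
  rintro _ ⟨e, he, rfl⟩
  rw [(hf.mono he.subset_vertexSet).encard_image, hG e he]

theorem image_eq_self {f : α → α} (h : ∀ v ∈ V(G), f v = v) : G.image f = G := by
  have himg : ∀ s ⊆ V(G), f '' s = s := fun s hs => by
    rw [Set.image_congr fun v hv => h v (hs hv), Set.image_id']
  refine Hypergraph.ext (himg _ subset_rfl) ?_
  rw [image_edgeSet, Set.image_congr fun e he => himg e he.subset_vertexSet, Set.image_id']

theorem IsIsomorphic.trans {H : Hypergraph β} {K : Hypergraph γ} (h₁ : G.IsIsomorphic H)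
    (h₂ : H.IsIsomorphic K) : G.IsIsomorphic K := by
  obtain ⟨f, hf, rfl⟩ := h₁
  obtain ⟨g, hg, rfl⟩ := h₂
  exact ⟨g ∘ f, hg.comp hf (Set.mapsTo_image f _), (image_image G).symm⟩

theorem IsIsomorphic.symm (hne : V(G).Nonempty) {H : Hypergraph β} (h : G.IsIsomorphic H) :
    H.IsIsomorphic G := by
  obtain ⟨f, hf, rfl⟩ := h
  obtain ⟨v₀, hv₀⟩ := hne
  have : Nonempty α := ⟨v₀⟩
  refine ⟨Function.invFunOn f V(G), ?_, ?_⟩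
  · rintro _ ⟨a, ha, rfl⟩ _ ⟨b, hb, rfl⟩ h
    rw [hf.leftInvOn_invFunOn ha, hf.leftInvOn_invFunOn hb] at h
    rw [h]
  · rw [image_image]
    exact image_eq_self fun v hv => hf.leftInvOn_invFunOn hv

theorem IsRayleighMin.image {f : α → β} (hf : Set.InjOn f V(G)) {k : ℕ} {c : ℝ}
    (h : IsRayleighMin k G c) : IsRayleighMin k (G.image f) c := by
  obtain ⟨h1, x, ⟨v, hv, hx⟩, h2⟩ := h
  have : Nonempty α := ⟨v⟩
  refine ⟨fun y => energy_image hf k _ y ▸ h1 _, x ∘ Function.invFunOn f V(G),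
    ⟨f v, ⟨v, hv, rfl⟩, by simpa [hf.leftInvOn_invFunOn hv] using hx⟩, ?_⟩
  rw [energy_image hf, ← h2]
  have hcongr : ∀ v ∈ V(G), ((x ∘ Function.invFunOn f V(G)) ∘ f) v = x v := fun v hv => by
    simp [hf.leftInvOn_invFunOn hv]
  unfold energy form
  congr 2
  · refine finsum_mem_congr rfl fun e he => finprod_mem_congr rfl fun v hv => ?_
    exact hcongr v (he.subset_vertexSet hv)
  · exact finsum_mem_congr rfl fun v hv => by rw [hcongr v hv]

end Image

/-! ### Vertices, edges and energy of a coalescence. -/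

section Coalescence

variable {α β : Type} {G : Hypergraph α} {T : Hypergraph β} {v : α} {r : β}

open Classical in
/-- The map of the vertices of the second hypergraph into a coalescence. -/
noncomputable def attachMap (v : α) (r : β) (x : β) : α ⊕ β := if x = r then Sum.inl v else Sum.inr x

theorem attachMap_self (v : α) (r : β) : attachMap v r r = Sum.inl v := if_pos rfl

theorem attachMap_of_ne (v : α) {r x : β} (h : x ≠ r) : attachMap v r x = Sum.inr x := if_neg h

theorem attachMap_image (v : α) {r : β} {s : Set β} (h : r ∉ s) :
    attachMap v r '' s = Sum.inr '' s :=
  Set.image_congr fun _ hx => attachMap_of_ne v (ne_of_mem_of_not_mem hx h)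

theorem attachMap_injective (v : α) (r : β) : Function.Injective (attachMap v r) := by
  intro x y h
  unfold attachMap at h
  split_ifs at h with h1 h2 h2
  · rw [h1, h2]
  · exact Sum.inr_injective h

theorem vertexSet_coalescence :
    V(G.coalescence v T r) = Sum.inl '' V(G) ∪ attachMap v r '' V(T) := rfl

theorem edgeSet_coalescence :
    E(G.coalescence v T r) =
      Set.image Sum.inl '' E(G) ∪ Set.image (attachMap v r) '' E(T) := rfl

theorem vertexSet_coalescence_eq (hv : v ∈ V(G)) :
    V(G.coalescence v T r) = Sum.inl '' V(G) ∪ Sum.inr '' (V(T) \ {r}) := by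
  rw [vertexSet_coalescence, ← attachMap_image v (by simp : r ∉ V(T) \ {r})]
  ext y
  constructor
  · rintro (h | ⟨x, hx, rfl⟩)
    · exact Or.inl h
    · by_cases hxr : x = r
      · rw [hxr, attachMap_self]
        exact Or.inl ⟨v, hv, rfl⟩
      · exact Or.inr ⟨x, ⟨hx, hxr⟩, rfl⟩
  · rintro (h | ⟨x, hx, rfl⟩)
    · exact Or.inl h
    · exact Or.inr ⟨x, hx.1, rfl⟩

/-- As `k ≥ 2`, an edge of `T` contains a vertex other than `r`, and this vertex stays outside the
copy of `G`. -/
theorem disjoint_edgeSet_coalescence {k : ℕ} (hk : 2 ≤ k) (hT : T.IsUniform k) :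
    Disjoint (Set.image (Sum.inl : α → α ⊕ β) '' E(G)) (Set.image (attachMap v r) '' E(T)) := by
  rw [Set.disjoint_left]
  rintro _ ⟨e, -, rfl⟩ ⟨f, hf, h⟩
  have hlt : 1 < f.encard := by
    rw [hT f hf]
    exact_mod_cast hk
  obtain ⟨x, hx, hxr⟩ := Set.exists_ne_of_one_lt_encard hlt r
  have : attachMap v r x ∈ Sum.inl '' e := h ▸ ⟨x, hx, rfl⟩
  rw [attachMap_of_ne v hxr] at this
  obtain ⟨y, -, hy⟩ := this
  cases hy

theorem finite_vertexSet_coalescence (hG : V(G).Finite) (hT : V(T).Finite) :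
    V(G.coalescence v T r).Finite := (hG.image _).union (hT.image _)

theorem IsUniform.coalescence {k : ℕ} (hG : G.IsUniform k) (hT : T.IsUniform k) :
    (G.coalescence v T r).IsUniform k := by
  rintro e (he | he)
  · exact hG.image Sum.inl_injective.injOn e he
  · exact hT.image (attachMap_injective v r).injOn e he

theorem ncard_edgeSet_coalescence {k : ℕ} (hk : 2 ≤ k) (hT : T.IsUniform k) (hVG : V(G).Finite)
    (hVT : V(T).Finite) : E(G.coalescence v T r).ncard = E(G).ncard + E(T).ncard := by
  rw [edgeSet_coalescence, Set.ncard_union_eq (disjoint_edgeSet_coalescence hk hT)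
    ((finite_edgeSet hVG).image _) ((finite_edgeSet hVT).image _),
    Set.ncard_image_of_injective _ (Set.image_injective.2 Sum.inl_injective),
    Set.ncard_image_of_injective _ (Set.image_injective.2 (attachMap_injective v r))]

/-- The common vertex is counted in `G`, which is why `branchEnergy` leaves out the root. -/
theorem energy_coalescence {k : ℕ} (hk : 2 ≤ k) (hT : T.IsUniform k) (hVG : V(G).Finite)
    (hVT : V(T).Finite) (hv : v ∈ V(G)) (μ : ℝ) (x : α ⊕ β → ℝ) :
    (G.coalescence v T r).energy k μ x =
      G.energy k μ (x ∘ Sum.inl) + T.branchEnergy r k μ (x ∘ attachMap v r) := by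
  have hform : (G.coalescence v T r).form x =
      G.form (x ∘ Sum.inl) + T.form (x ∘ attachMap v r) := by
    rw [← form_image Sum.inl_injective.injOn, ← form_image (attachMap_injective v r).injOn]
    exact finsum_mem_union (disjoint_edgeSet_coalescence hk hT)
      ((finite_edgeSet hVG).image _) ((finite_edgeSet hVT).image _)
  have hpow : ∑ᶠ y ∈ V(G.coalescence v T r), x y ^ k =
      ∑ᶠ y ∈ V(G), (x ∘ Sum.inl) y ^ k + ∑ᶠ y ∈ V(T) \ {r}, (x ∘ attachMap v r) y ^ k := by
    rw [vertexSet_coalescence_eq hv, finsum_mem_union ?_ (hVG.image _) (hVT.sdiff.image _),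
      finsum_mem_image Sum.inl_injective.injOn, finsum_mem_image Sum.inr_injective.injOn]
    · congr 1
      refine finsum_mem_congr rfl fun y hy => ?_
      rw [Function.comp_apply, attachMap_of_ne v hy.2]
    · rw [Set.disjoint_left]
      rintro _ ⟨y, -, rfl⟩ ⟨z, -, hz⟩
      cases hz
  unfold energy branchEnergy
  rw [hform, hpow]
  ring

end Coalescence

/-! ### Reduction of attached hypertrees to vertex weights. -/

section Pendant

variable {α₀ α β : Type}

/-- Up to the embedding `ι`, the hypergraph `H` arises from `C` by attaching pendant edges at `u`,
whose sets of other vertices are the members of `D`. -/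
structure IsPendant (k : ℕ) (C : Hypergraph α₀) (H : Hypergraph α) (ι : α₀ → α) (u : α₀)
    (D : Set (Set α)) : Prop where
  injOn : Set.InjOn ι V(C)
  disjoint : D.PairwiseDisjoint id
  encard : ∀ d ∈ D, d.encard = (k - 1 : ℕ)
  disjoint_image : ∀ d ∈ D, Disjoint (ι '' V(C)) d
  vertexSet : V(H) = ι '' V(C) ∪ ⋃₀ D
  edgeSet : E(H) = Set.image ι '' E(C) ∪ insert (ι u) '' D

theorem isPendant_refl (k : ℕ) (C : Hypergraph α₀) (u : α₀) : IsPendant k C C id u ∅ := by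
  constructor <;> simp

/-- The alternative `D' = ∅` covers a single vertex, which may be attached anywhere without effect.
-/
theorem IsPendant.coalescence {k : ℕ} {C : Hypergraph α₀} {H : Hypergraph α} {ι : α₀ → α}
    {u v : α₀} {D : Set (Set α)} (h : IsPendant k C H ι u D) {T : Hypergraph β} {r : β}
    {D' : Set (Set β)} (hT : T.IsStarAt k r D') (hv : v ∈ V(C)) (hvu : D' = ∅ ∨ v = u) :
    IsPendant k C (H.coalescence (ι v) T r) (Sum.inl ∘ ι) u
      (Set.image Sum.inl '' D ∪ Set.image Sum.inr '' D') := by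
  have hιv : ι v ∈ V(H) := h.vertexSet ▸ Or.inl ⟨v, hv, rfl⟩
  have hlr : ∀ (s : Set α) (t : Set β), Disjoint (Sum.inl '' s) (Sum.inr '' t) := by
    intro s t
    rw [Set.disjoint_left]
    rintro _ ⟨y, -, rfl⟩ ⟨z, -, hz⟩
    cases hz
  refine ⟨Sum.inl_injective.comp_injOn h.injOn, ?_, ?_, ?_, ?_, ?_⟩
  · rintro _ (⟨d, hd, rfl⟩ | ⟨d, hd, rfl⟩) _ (⟨d', hd', rfl⟩ | ⟨d', hd', rfl⟩) hne
    · exact (Set.disjoint_image_iff Sum.inl_injective).2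
        (h.disjoint hd hd' fun heq => hne (by rw [heq]))
    · exact hlr _ _
    · exact (hlr _ _).symm
    · exact (Set.disjoint_image_iff Sum.inr_injective).2
        (hT.disjoint hd hd' fun heq => hne (by rw [heq]))
  · rintro _ (⟨d, hd, rfl⟩ | ⟨d, hd, rfl⟩)
    · rw [Sum.inl_injective.encard_image, h.encard d hd]
    · rw [Sum.inr_injective.encard_image, hT.encard d hd]
  · rintro _ (⟨d, hd, rfl⟩ | ⟨d, hd, rfl⟩)
    · rw [Set.image_comp]
      exact (Set.disjoint_image_iff Sum.inl_injective).2 (h.disjoint_image d hd)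
    · rw [Set.image_comp]
      exact hlr _ _
  · have hr : r ∉ ⋃₀ D' := fun ⟨d, hd, hrd⟩ => hT.notMem d hd hrd
    rw [vertexSet_coalescence_eq hιv, hT.vertexSet, Set.insert_sdiff_self_of_notMem hr, h.vertexSet,
      Set.image_union, Set.image_comp, Set.image_sUnion, Set.image_sUnion, Set.sUnion_union,
      Set.union_assoc]
  · have h1 : Set.image (Sum.inl : α → α ⊕ β) '' (Set.image ι '' E(C)) =
        Set.image (Sum.inl ∘ ι) '' E(C) := by
      rw [Set.image_image]
      exact Set.image_congr fun e _ => (Set.image_comp _ _ _).symm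
    have h2 : Set.image (Sum.inl : α → α ⊕ β) '' (insert (ι u) '' D) =
        insert ((Sum.inl ∘ ι) u) '' (Set.image Sum.inl '' D) := by
      rw [Set.image_image, Set.image_image]
      exact Set.image_congr fun d _ => Set.image_insert_eq
    have h3 : Set.image (attachMap (ι v) r) '' E(T) =
        insert ((Sum.inl ∘ ι) u) '' (Set.image Sum.inr '' D') := by
      rw [hT.edgeSet, Set.image_image, Set.image_image]
      refine Set.image_congr fun d hd => ?_
      obtain rfl | rfl := hvu
      · exact absurd hd (Set.notMem_empty d)
      · rw [Set.image_insert_eq, attachMap_self, attachMap_image _ (hT.notMem d hd)]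
        rfl
    rw [edgeSet_coalescence, h.edgeSet, Set.image_union, h1, h2, h3, Set.image_union,
      Set.union_assoc]

theorem isStarAt_empty {T : Hypergraph β} (k : ℕ) (hH : T.IsHypertree) {r : β} (hr : r ∈ V(T))
    (hE : E(T).ncard = 0) : T.IsStarAt k r ∅ := by
  have hE : E(T) = ∅ := (Set.ncard_eq_zero (finite_edgeSet hH.1)).1 hE
  obtain ⟨p, hp⟩ := hH.exists_isParentMap (by simp [hE]) hr
  have h := hp.iUnion
  rw [hE, Set.biUnion_empty] at h
  refine ⟨by simp, by simp, by simp, ?_, by simp [hE]⟩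
  rw [Set.sUnion_empty, ← Set.insert_eq_of_mem hr, ← Set.insert_sdiff_singleton, ← h]

/-- The energy that remains on `C` when `n v` pendant edges at each vertex `v` of `C` are
eliminated. -/
noncomputable def weightEnergy [Fintype α₀] (C : Hypergraph α₀) (k : ℕ) (μ : ℝ) (n : α₀ → ℕ)
    (z : α₀ → ℝ) : ℝ :=
  C.energy k μ z - ∑ v, n v * ((μ ^ (k - 1))⁻¹ * z v ^ k)

/-- What a hypergraph obtained by attaching hypertrees to `C` has in common with one obtained by
attaching `n v` pendant edges at each vertex `v`. -/
structure HasWeight [Fintype α₀] (k : ℕ) (C : Hypergraph α₀) (H : Hypergraph α) (ι : α₀ → α)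
    (n : α₀ → ℕ) : Prop where
  ncard : E(H).ncard = E(C).ncard + ∑ v, n v
  le : ∀ μ : ℝ, 0 < μ → ((∑ v, n v : ℕ) : ℝ) ≤ μ ^ k → ∀ x : α → ℝ,
    C.weightEnergy k μ n (x ∘ ι) ≤ H.energy k μ x
  eq_zero : ∀ μ : ℝ, 0 < μ → ((∑ v, n v : ℕ) : ℝ) < μ ^ k → ∀ x : α → ℝ,
    C.weightEnergy k μ n (x ∘ ι) = H.energy k μ x → (∀ v ∈ V(C), x (ι v) = 0) →
      ∀ v ∈ V(H), x v = 0
  isPendant : ∀ μ : ℝ, 0 < μ → ((∑ v, n v : ℕ) : ℝ) < μ ^ k → ∀ x : α → ℝ,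
    C.weightEnergy k μ n (x ∘ ι) = H.energy k μ x →
      ∀ u, (∀ v, 0 < n v → v = u ∧ x (ι u) ≠ 0) → ∃ D, IsPendant k C H ι u D

theorem AttachHypertrees.mapsTo_and {k : ℕ} {C : Hypergraph α₀} {H : Hypergraph α} {ι : α₀ → α}
    (h : AttachHypertrees k C H ι) (hC : C.IsUniform k) (hVC : V(C).Finite) :
    Set.MapsTo ι V(C) V(H) ∧ H.IsUniform k ∧ V(H).Finite := by
  induction h with
  | refl => exact ⟨Set.mapsTo_id _, hC, hVC⟩
  | attach _ hT hH _ _ ih =>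
    exact ⟨fun w hw => Or.inl ⟨_, ih.1 hw, rfl⟩, ih.2.1.coalescence hT,
      finite_vertexSet_coalescence ih.2.2 hH.1⟩

/-- Induction over the attachments: each hypertree adds its number of edges to the weight of its
vertex, and `IsHypertree.branchEnergy_bound` supplies the inequality and its case of equality. -/
theorem AttachHypertrees.exists_hasWeight [Fintype α₀] {k : ℕ} (hk : Even k) (hk2 : 2 ≤ k)
    {C : Hypergraph α₀} (hC : C.IsUniform k) {H : Hypergraph α} {ι : α₀ → α}
    (h : AttachHypertrees k C H ι) : ∃ n, HasWeight k C H ι n := by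
  classical
  induction h with
  | refl =>
    refine ⟨0, by simp, ?_, fun μ _ _ x _ h => h, fun μ _ _ x _ u _ => ⟨∅, isPendant_refl k C u⟩⟩
    intro μ _ _ x
    simp [weightEnergy]
  | @attach α β G ι T v r hG hT hH hv hr ih =>
    obtain ⟨n, hn⟩ := ih
    obtain ⟨hmaps, hGu, hVG⟩ := hG.mapsTo_and hC (Set.toFinite _)
    let n' : α₀ → ℕ := fun w => n w + if w = v then E(T).ncard else 0
    have hsum : ∑ w, n' w = ∑ w, n w + E(T).ncard := by
      simp [n', Finset.sum_add_distrib]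
    have hweight : ∀ (μ : ℝ) (z : α₀ → ℝ), C.weightEnergy k μ n' z =
        C.weightEnergy k μ n z + -(E(T).ncard * ((μ ^ (k - 1))⁻¹ * z v ^ k)) := by
      intro μ z
      have : ∑ w, (n' w : ℝ) * ((μ ^ (k - 1))⁻¹ * z w ^ k) =
          ∑ w, (n w : ℝ) * ((μ ^ (k - 1))⁻¹ * z w ^ k) +
            E(T).ncard * ((μ ^ (k - 1))⁻¹ * z v ^ k) := by
        simp [n', add_mul, Finset.sum_add_distrib]
      unfold weightEnergy
      rw [this]
      ring
    have henergy := fun (μ : ℝ) x => energy_coalescence (r := r) hk2 hT hVG hH.1 (hmaps hv) μ x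
    have hbranch := fun (μ : ℝ) (hμ : 0 < μ) (hm : (E(T).ncard : ℝ) ≤ μ ^ k)
        (x : α ⊕ β → ℝ) =>
      hH.branchEnergy_bound hk (by omega) hT hr hμ hm (x ∘ attachMap (ι v) r)
    have hroot : ∀ x : α ⊕ β → ℝ,
        (x ∘ attachMap (ι v) r) r = ((x ∘ Sum.inl) ∘ ι) v := fun x => by
      simp [attachMap_self]
    have hle1 : ((∑ w, n w : ℕ) : ℝ) ≤ (∑ w, n' w : ℕ) := by
      rw [hsum]
      exact_mod_cast Nat.le_add_right _ _
    have hle2 : (E(T).ncard : ℝ) ≤ (∑ w, n' w : ℕ) := by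
      rw [hsum]
      exact_mod_cast Nat.le_add_left _ _
    -- Equality in the sum of two inequalities forces equality in each.
    have hsplit : ∀ μ : ℝ, 0 < μ → ((∑ w, n' w : ℕ) : ℝ) < μ ^ k → ∀ x : α ⊕ β → ℝ,
        C.weightEnergy k μ n' (x ∘ Sum.inl ∘ ι) =
          (G.coalescence (ι v) T r).energy k μ x →
        C.weightEnergy k μ n ((x ∘ Sum.inl) ∘ ι) = G.energy k μ (x ∘ Sum.inl) ∧
        (x (Sum.inl (ι v)) = 0 → ∀ w ∈ V(T), x (attachMap (ι v) r w) = 0) ∧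
        (x (Sum.inl (ι v)) ≠ 0 → ∃ D, T.IsStarAt k r D) := by
      intro μ hμ hm x heq
      have h1 := hn.le μ hμ (hle1.trans hm.le) (x ∘ Sum.inl)
      have h2 := hbranch μ hμ (hle2.trans hm.le) x
      rw [hroot] at h2
      rw [henergy, hweight, ← Function.comp_assoc] at heq
      have h3 := h2.2 (by linarith [h2.1]) (hle2.trans_lt hm)
      exact ⟨by linarith [h2.1], h3⟩
    refine ⟨n', ?_, ?_, ?_, ?_⟩
    · rw [ncard_edgeSet_coalescence hk2 hT hVG hH.1, hn.ncard, hsum, add_assoc]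
    · intro μ hμ hm x
      have h1 := hn.le μ hμ (hle1.trans hm) (x ∘ Sum.inl)
      have h2 := (hbranch μ hμ (hle2.trans hm) x).1
      rw [hroot] at h2
      rw [henergy, hweight, ← Function.comp_assoc]
      linarith
    · intro μ hμ hm x heq hz
      obtain ⟨h1, h2, -⟩ := hsplit μ hμ hm x heq
      have h3 := hn.eq_zero μ hμ (hle1.trans_lt hm) (x ∘ Sum.inl) h1 hz
      rintro _ (⟨w, hw, rfl⟩ | ⟨w, hw, rfl⟩)
      · exact h3 w hw
      · exact h2 (hz v hv) w hw
    · intro μ hμ hm x heq u hu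
      obtain ⟨h1, -, h3⟩ := hsplit μ hμ hm x heq
      obtain ⟨D, hD⟩ := hn.isPendant μ hμ (hle1.trans_lt hm) (x ∘ Sum.inl) h1 u
        fun w hw => hu w (by simp only [n']; omega)
      -- A hypertree without edges adds no weight, so `hu` need not say anything about its vertex
      -- `v`.
      by_cases hE : E(T).ncard = 0
      · exact ⟨_, hD.coalescence (isStarAt_empty k hH hr hE) hv (Or.inl rfl)⟩
      · obtain ⟨rfl, hxu⟩ := hu v (by simp only [n', if_pos]; omega)
        obtain ⟨D', hD'⟩ := h3 hxu
        exact ⟨_, hD.coalescence hD' hv (Or.inr rfl)⟩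

end Pendant

/-! ### Test vectors supported on one edge. -/

section TestVectors

variable {α : Type}

/-- A vector on `e` with value `b` at `u` and values `± |b| * t` elsewhere, for which the product
over `e` is negative. -/
theorem exists_edge_vector {k : ℕ} (hk : Even k) (hk2 : 2 ≤ k) {d : Set α}
    (hd : d.encard = (k - 1 : ℕ)) (b t : ℝ) :
    ∃ y : α → ℝ, b * ∏ᶠ v ∈ d, y v = -(b ^ k * t ^ (k - 1)) ∧ ∀ v, y v ^ k = b ^ k * t ^ k := by
  classical
  have hfin : d.Finite := Set.finite_of_encard_eq_coe hd
  lift d to Finset α using hfin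
  rw [Set.encard_coe_eq_coe_finsetCard] at hd
  have hd : d.card = k - 1 := by exact_mod_cast hd
  obtain ⟨c, hc⟩ : d.Nonempty := Finset.card_pos.1 (by omega)
  obtain ⟨j, rfl⟩ : ∃ j, k = j + 2 := ⟨k - 2, by omega⟩
  have hj : Even j := by
    rw [Nat.even_add] at hk
    exact hk.2 even_two
  -- The vertex `c` carries the sign opposite to that of `b * t`; the other `k - 2` vertices are
  -- even in number, so `|b|` becomes `b` in their product.
  refine ⟨fun v => if v = c then -(b * t) else |b| * t, ?_, fun v => ?_⟩
  · have hprod : ∏ v ∈ d.erase c, (if v = c then -(b * t) else |b| * t) = (|b| * t) ^ j := by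
      rw [Finset.prod_congr rfl fun v hv => if_neg (Finset.ne_of_mem_erase hv), Finset.prod_const,
        Finset.card_erase_of_mem hc, hd]
      rfl
    rw [finprod_mem_coe_finset, ← Finset.mul_prod_erase d _ hc, hprod, if_pos rfl, mul_pow,
      hj.pow_abs]
    simp only [Nat.add_succ_sub_one]
    ring
  · dsimp only
    split_ifs
    · rw [hk.neg_pow, mul_pow]
    · rw [mul_pow, hk.pow_abs]

theorem finsum_mem_pow_eq {d : Set α} {k : ℕ} (hd : d.encard = (k : ℕ)) {f : α → ℝ} {a : ℝ}
    (h : ∀ v ∈ d, f v = a) : ∑ᶠ v ∈ d, f v = k * a := by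
  have hfin : d.Finite := Set.finite_of_encard_eq_coe hd
  rw [finsum_mem_congr rfl h]
  lift d to Finset α using hfin
  rw [Set.encard_coe_eq_coe_finsetCard] at hd
  have hd : d.card = k := by exact_mod_cast hd
  rw [finsum_mem_coe_finset, Finset.sum_const, hd, nsmul_eq_mul]

/-- The vector is `1` at `u`, `± t` on the rest of `e` and zero elsewhere. Any other edge has the
same size, hence leaves `e` and contributes nothing. -/
theorem exists_energy_edge {G : Hypergraph α} {k : ℕ} (hk : Even k) (hk2 : 2 ≤ k)
    (hG : G.IsUniform k) (hV : V(G).Finite) {e : Set α} (he : e ∈ E(G)) {u : α} (hu : u ∈ e)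
    (μ t : ℝ) : ∃ z : α → ℝ, z u = 1 ∧
      G.energy k μ z = μ * (1 + (k - 1 : ℕ) * t ^ k) - k * t ^ (k - 1) := by
  classical
  have hk0 : k ≠ 0 := by omega
  have hd : (e \ {u}).encard = (k - 1 : ℕ) := by
    rw [Set.encard_sdiff_singleton_of_mem hu, hG e he]
    norm_cast
  obtain ⟨y, hy1, hy2⟩ := exists_edge_vector hk hk2 hd 1 t
  simp only [one_pow, one_mul] at hy1 hy2
  let z : α → ℝ := fun v => if v = u then 1 else if v ∈ e then y v else 0
  have hzu : z u = 1 := if_pos rfl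
  have hze : ∀ v ∈ e \ {u}, z v = y v := fun v hv => by
    have hvu : v ≠ u := hv.2
    simp only [z, if_neg hvu, if_pos hv.1]
  have hz0 : ∀ v ∉ e, z v = 0 := fun v hv => by
    simp only [z, if_neg hv, if_neg (ne_of_mem_of_not_mem hu hv).symm]
  have hefin : e.Finite := hV.subset he.subset_vertexSet
  have hins : insert u (e \ {u}) = e := by
    rw [Set.insert_sdiff_singleton, Set.insert_eq_of_mem hu]
  have hprod : ∏ᶠ v ∈ e, z v = -t ^ (k - 1) := by
    conv_lhs => rw [← hins]
    rw [finprod_mem_insert _ (by simp) hefin.sdiff, hzu, one_mul,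
      finprod_mem_congr rfl hze, hy1]
  have hform : G.form z = -t ^ (k - 1) := by
    have hother : ∀ f ∈ E(G) \ {e}, ∏ᶠ v ∈ f, z v = 0 := by
      rintro f ⟨hf, hfe⟩
      have hffin : f.Finite := hV.subset hf.subset_vertexSet
      obtain ⟨v, hvf, hve⟩ : ∃ v ∈ f, v ∉ e := by
        by_contra! hsub
        refine hfe (hffin.eq_of_subset_of_encard_le hsub ?_)
        rw [hG e he, hG f hf]
      rw [finprod_mem_eq_finite_toFinset_prod _ hffin]
      exact Finset.prod_eq_zero (hffin.mem_toFinset.2 hvf) (hz0 v hve)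
    unfold form
    conv_lhs => rw [← Set.insert_eq_of_mem he, ← Set.insert_sdiff_singleton]
    rw [finsum_mem_insert _ (by simp) (finite_edgeSet hV).sdiff, hprod,
      finsum_mem_congr rfl hother, finsum_mem_zero, add_zero]
  have hpow : ∑ᶠ v ∈ V(G), z v ^ k = 1 + (k - 1 : ℕ) * t ^ k := by
    have hsub : ∑ᶠ v ∈ V(G), z v ^ k = ∑ᶠ v ∈ e, z v ^ k := by
      refine finsum_mem_inter_support_eq' _ _ _ fun v hv => ⟨fun _ => ?_, fun h => he.subset_vertexSet h⟩
      by_contra hve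
      exact hv (by simp [hz0 v hve, hk0])
    rw [hsub]
    conv_lhs => rw [← hins]
    rw [finsum_mem_insert _ (by simp) hefin.sdiff, hzu, one_pow,
      finsum_mem_pow_eq hd fun v hv => by rw [hze v hv, hy2]]
  refine ⟨z, hzu, ?_⟩
  rw [energy, hform, hpow]
  ring

theorem one_le_of_energy_nonneg {G : Hypergraph α} {k : ℕ} (hk : Even k) (hk2 : 2 ≤ k)
    (hG : G.IsUniform k) (hV : V(G).Finite) {e : Set α} (he : e ∈ E(G)) {μ : ℝ}
    (hμ : ∀ x, 0 ≤ G.energy k μ x) : 1 ≤ μ := by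
  have hne : e.Nonempty := by
    rw [← Set.encard_pos, hG e he]
    exact_mod_cast (by omega : 0 < k)
  obtain ⟨u, hu⟩ := hne
  obtain ⟨z, -, hz⟩ := exists_energy_edge hk hk2 hG hV he hu μ 1
  have h := hμ z
  rw [hz, Nat.cast_sub (by omega)] at h
  simp only [one_pow, mul_one, Nat.cast_one] at h
  have hkpos : (0 : ℝ) < k := by exact_mod_cast (by omega : 0 < k)
  nlinarith

end TestVectors

/-! ### Stars attain the bound. -/

section Star

variable {α : Type} {T : Hypergraph α} {k : ℕ} {r : α} {D : Set (Set α)}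

theorem IsStarAt.injOn_insert (h : T.IsStarAt k r D) : Set.InjOn (insert r) D := by
  intro d hd d' hd' heq
  rw [← Set.insert_sdiff_self_of_notMem (h.notMem d hd),
    ← Set.insert_sdiff_self_of_notMem (h.notMem d' hd'), heq]

theorem IsStarAt.ncard (h : T.IsStarAt k r D) : E(T).ncard = D.ncard := by
  rw [h.edgeSet, h.injOn_insert.ncard_image]

theorem IsStarAt.isUniform (h : T.IsStarAt k r D) (hk : 0 < k) : T.IsUniform k := by
  intro e he
  rw [h.edgeSet] at he
  obtain ⟨d, hd, rfl⟩ := he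
  rw [Set.encard_insert_of_notMem (h.notMem d hd), h.encard d hd]
  exact_mod_cast Nat.sub_add_cancel hk

theorem IsStarAt.isHypertree (h : T.IsStarAt k r D) (hD : D.Finite) : T.IsHypertree := by
  have hr : r ∈ V(T) := h.vertexSet ▸ Set.mem_insert _ _
  have hadj : ∀ v ∈ V(T), v = r ∨ T.Adj r v := by
    intro v hv
    rw [h.vertexSet] at hv
    obtain hv | ⟨d, hd, hvd⟩ := hv
    · exact Or.inl hv
    · exact Or.inr ⟨insert r d, h.edgeSet ▸ ⟨d, hd, rfl⟩, Set.mem_insert _ _, Or.inr hvd⟩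
  refine ⟨?_, ⟨⟨r, hr⟩, fun u hu v hv => ?_⟩, ?_⟩
  · rw [h.vertexSet]
    exact (hD.sUnion fun d hd => Set.finite_of_encard_eq_coe (h.encard d hd)).insert r
  · have h1 : Relation.ReflTransGen T.Adj u r := by
      obtain rfl | hu := hadj u hu
      · exact .refl
      · exact .single hu.symm
    have h2 : Relation.ReflTransGen T.Adj r v := by
      obtain rfl | hv := hadj v hv
      · exact .refl
      · exact .single hv
    exact h1.trans h2
  · rintro ⟨l, v, e, hv, he, hve⟩
    -- Consecutive edges of a Berge cycle are distinct, and distinct edges of a star share only `r`.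
    -- So every vertex of the cycle would be `r`.
    have hroot : ∀ i : Fin (l + 2), v (i + 1) = r := by
      intro i
      have hne : e i ≠ e (i + 1) := fun heq => by
        have := he heq
        simp at this
      have h1 := (hve i).2.2
      have h2 := (hve (i + 1)).2.1
      obtain ⟨d, hd, hde⟩ := h.edgeSet ▸ (hve i).1
      obtain ⟨d', hd', hde'⟩ := h.edgeSet ▸ (hve (i + 1)).1
      rw [← hde] at h1
      rw [← hde'] at h2
      obtain h1 | h1 := h1
      · exact h1
      obtain h2 | h2 := h2
      · exact h2
      refine absurd ?_ (Set.disjoint_left.1 (h.disjoint hd hd' fun heq => hne ?_) h1)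
      · simpa using h2
      · rw [← hde, ← hde', heq]
    have h1 := hv ((hroot 0).trans (hroot 1).symm)
    simp at h1

/-- The energy of a star with fixed value at the centre attains the bound for hypertrees. -/
theorem IsStarAt.exists_branchEnergy (h : T.IsStarAt k r D) (hD : D.Finite) (hk : Even k)
    (hk2 : 2 ≤ k) {μ : ℝ} (hμ : 0 < μ) (b : ℝ) : ∃ y : α → ℝ, y r = b ∧
      T.branchEnergy r k μ y = -(D.ncard * ((μ ^ (k - 1))⁻¹ * b ^ k)) := by
  classical
  have hex : ∀ d : Set α, ∃ y : α → ℝ, d ∈ D →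
      b * ∏ᶠ v ∈ d, y v = -(b ^ k * μ⁻¹ ^ (k - 1)) ∧ ∀ v, y v ^ k = b ^ k * μ⁻¹ ^ k := by
    intro d
    by_cases hd : d ∈ D
    · obtain ⟨y, hy⟩ := exists_edge_vector hk hk2 (h.encard d hd) b μ⁻¹
      exact ⟨y, fun _ => hy⟩
    · exact ⟨0, fun h => absurd h hd⟩
  choose Y hY using hex
  let y : α → ℝ := fun v => if hv : ∃ d ∈ D, v ∈ d then Y hv.choose v else b
  have hyd : ∀ d ∈ D, ∀ v ∈ d, y v = Y d v := by
    intro d hd v hv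
    have hex : ∃ d ∈ D, v ∈ d := ⟨d, hd, hv⟩
    have heq : hex.choose = d := by
      by_contra hne
      exact Set.disjoint_left.1 (h.disjoint hex.choose_spec.1 hd hne) hex.choose_spec.2 hv
    simp only [y, dif_pos hex]
    rw [heq]
  have hyr : y r = b := dif_neg fun ⟨d, hd, hrd⟩ => h.notMem d hd hrd
  have hfin : ∀ d ∈ D, d.Finite := fun d hd => Set.finite_of_encard_eq_coe (h.encard d hd)
  have hform : T.form y = D.ncard * -(b ^ k * μ⁻¹ ^ (k - 1)) := by
    unfold form
    rw [h.edgeSet, finsum_mem_image h.injOn_insert, ← finsum_mem_pow_eq (k := D.ncard) _ fun _ _ => rfl]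
    · refine finsum_mem_congr rfl fun d hd => ?_
      rw [finprod_mem_insert _ (h.notMem d hd) (hfin d hd), hyr,
        finprod_mem_congr rfl (hyd d hd), (hY d hd).1]
    · exact hD.cast_ncard_eq.symm
  have hpow : ∑ᶠ v ∈ V(T) \ {r}, y v ^ k = D.ncard * ((k - 1 : ℕ) * (b ^ k * μ⁻¹ ^ k)) := by
    have hr : r ∉ ⋃₀ D := fun ⟨d, hd, hrd⟩ => h.notMem d hd hrd
    rw [h.vertexSet, Set.insert_sdiff_self_of_notMem hr, finsum_mem_sUnion h.disjoint hD hfin,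
      ← finsum_mem_pow_eq (k := D.ncard) _ fun _ _ => rfl]
    · refine finsum_mem_congr rfl fun d hd => ?_
      exact finsum_mem_pow_eq (h.encard d hd) fun v hv => by rw [hyd d hd v hv, (hY d hd).2]
    · exact hD.cast_ncard_eq.symm
  refine ⟨y, hyr, ?_⟩
  have hμk : μ⁻¹ ^ k = μ⁻¹ ^ (k - 1) * μ⁻¹ := (pow_sub_one_mul (by omega) _).symm
  rw [branchEnergy, hform, hpow, hμk, Nat.cast_sub (by omega), inv_pow]
  field_simp
  push_cast
  ring

end Star

/-! ### Uniqueness of a hypergraph with pendant edges at one vertex. -/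

section Pendant

variable {α₀ α β : Type} {k : ℕ} {C : Hypergraph α₀} {H : Hypergraph α} {ι : α₀ → α} {u : α₀}
  {D : Set (Set α)}

theorem IsPendant.ncard (h : IsPendant k C H ι u D) (hk2 : 2 ≤ k) (hu : u ∈ V(C))
    (hE : E(H).Finite) : E(H).ncard = E(C).ncard + D.ncard ∧ D.Finite := by
  have hnot : ∀ d ∈ D, ι u ∉ d := fun d hd =>
    Set.disjoint_left.1 (h.disjoint_image d hd) ⟨u, hu, rfl⟩
  have hinj : Set.InjOn (insert (ι u)) D := by
    intro d hd d' hd' heq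
    rw [← Set.insert_sdiff_self_of_notMem (hnot d hd),
      ← Set.insert_sdiff_self_of_notMem (hnot d' hd'), heq]
  have hdisj : Disjoint (Set.image ι '' E(C)) (insert (ι u) '' D) := by
    rw [Set.disjoint_left]
    rintro _ ⟨e, he, rfl⟩ ⟨d, hd, heq⟩
    have hne : d.Nonempty := by
      rw [← Set.encard_pos, h.encard d hd]
      exact_mod_cast (by omega : 0 < k - 1)
    obtain ⟨a, ha⟩ := hne
    have : a ∈ ι '' e := heq ▸ Or.inr ha
    exact Set.disjoint_left.1 (h.disjoint_image d hd)
      (Set.image_mono he.subset_vertexSet this) ha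
  rw [h.edgeSet] at hE ⊢
  have h1 := hE.subset Set.subset_union_left
  have h2 := hE.subset Set.subset_union_right
  exact ⟨by rw [Set.ncard_union_eq hdisj h1 h2, hinj.ncard_image,
    (injOn_image_edgeSet h.injOn).ncard_image], h2.of_finite_image hinj⟩

/-- An automorphism `σ` of `C` relabels the vertex at which the pendant edges sit. -/
theorem IsPendant.comp (h : IsPendant k C H ι u D) {σ : α₀ → α₀} (hσ : Set.InjOn σ V(C))
    (hC : C.image σ = C) {u' : α₀} (hu : σ u' = u) : IsPendant k C H (ι ∘ σ) u' D := by
  have hV : σ '' V(C) = V(C) := congrArg Hypergraph.vertexSet hC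
  have hE : Set.image σ '' E(C) = E(C) := congrArg Hypergraph.edgeSet hC
  have hι : (ι ∘ σ) '' V(C) = ι '' V(C) := by rw [Set.image_comp, hV]
  refine ⟨h.injOn.comp hσ fun v hv => hV ▸ Set.mem_image_of_mem σ hv, h.disjoint, h.encard,
    fun d hd => hι ▸ h.disjoint_image d hd, hι ▸ h.vertexSet, ?_⟩
  have : Set.image (ι ∘ σ) '' E(C) = Set.image ι '' E(C) := by
    conv_rhs => rw [← hE]
    rw [Set.image_image]
    exact Set.image_congr fun e _ => Set.image_comp _ _ _
  rw [this, Function.comp_apply, hu]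
  exact h.edgeSet

/-- Two hypergraphs that arise from `C` by attaching the same number of pendant edges at `u` are
isomorphic. -/
theorem IsPendant.isIsomorphic (h : IsPendant k C H ι u D) {H' : Hypergraph β} {ι' : α₀ → β}
    {D' : Set (Set β)} (h' : IsPendant k C H' ι' u D') (hu : u ∈ V(C)) (hD : D.Finite)
    (hD' : D'.Finite) (hcard : D.ncard = D'.ncard) : H.IsIsomorphic H' := by
  classical
  have hβ : Nonempty β := ⟨ι' u⟩
  have hα₀ : Nonempty α₀ := ⟨u⟩
  obtain ⟨Φ, hΦ⟩ := hD.exists_bijOn_of_encard_eq (t := D')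
    (by rw [← hD.cast_ncard_eq, ← hD'.cast_ncard_eq, hcard])
  have hex : ∀ d, ∃ ψ : α → β, d ∈ D → Set.BijOn ψ d (Φ d) := by
    intro d
    by_cases hd : d ∈ D
    · have hfin : d.Finite := Set.finite_of_encard_eq_coe (h.encard d hd)
      obtain ⟨ψ, hψ⟩ := hfin.exists_bijOn_of_encard_eq (t := Φ d)
        (by rw [h.encard d hd, h'.encard _ (hΦ.mapsTo hd)])
      exact ⟨ψ, fun _ => hψ⟩
    · exact ⟨fun _ => ι' u, fun h => absurd h hd⟩
  choose ψ hψ using hex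
  -- Glue the bijections between matched leaf sets to the identification of the two copies of `C`.
  let f : α → β := fun a =>
    if hv : ∃ d ∈ D, a ∈ d then ψ hv.choose a else ι' (Function.invFunOn ι V(C) a)
  have hfι : ∀ v ∈ V(C), f (ι v) = ι' v := by
    intro v hv
    have hnex : ¬ ∃ d ∈ D, ι v ∈ d := fun ⟨d, hd, hvd⟩ =>
      Set.disjoint_left.1 (h.disjoint_image d hd) ⟨v, hv, rfl⟩ hvd
    simp only [f, dif_neg hnex, h.injOn.leftInvOn_invFunOn hv]
  have hfd : ∀ d ∈ D, ∀ a ∈ d, f a = ψ d a := by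
    intro d hd a ha
    have hex : ∃ d ∈ D, a ∈ d := ⟨d, hd, ha⟩
    have heq : hex.choose = d := by
      by_contra hne
      exact Set.disjoint_left.1 (h.disjoint hex.choose_spec.1 hd hne) hex.choose_spec.2 ha
    simp only [f, dif_pos hex]
    rw [heq]
  have himgι : ∀ s ⊆ V(C), f '' (ι '' s) = ι' '' s := fun s hs => by
    rw [Set.image_image]
    exact Set.image_congr fun v hv => hfι v (hs hv)
  have himgd : ∀ d ∈ D, f '' d = Φ d := fun d hd => by
    rw [Set.image_congr (hfd d hd), (hψ d hd).image_eq]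
  have hsep : ∀ v ∈ V(C), ∀ d ∈ D, ∀ a ∈ d, f (ι v) ≠ f a := by
    intro v hv d hd a ha heq
    rw [hfι v hv, hfd d hd a ha] at heq
    exact Set.disjoint_left.1 (h'.disjoint_image _ (hΦ.mapsTo hd)) ⟨v, hv, heq⟩
      ((hψ d hd).mapsTo ha)
  refine ⟨f, ?_, Hypergraph.ext ?_ ?_⟩
  · rw [h.vertexSet]
    rintro _ (⟨v, hv, rfl⟩ | ⟨d, hd, ha⟩) _ (⟨v', hv', rfl⟩ | ⟨d', hd', ha'⟩) heq
    · rw [hfι v hv, hfι v' hv'] at heq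
      rw [h'.injOn hv hv' heq]
    · exact absurd heq (hsep v hv d' hd' _ ha')
    · exact absurd heq.symm (hsep v' hv' d hd _ ha)
    · rw [hfd d hd _ ha, hfd d' hd' _ ha'] at heq
      have hdd : d = d' := by
        refine hΦ.injOn hd hd' ?_
        by_contra hne
        exact Set.disjoint_left.1 (h'.disjoint (hΦ.mapsTo hd) (hΦ.mapsTo hd') hne)
          ((hψ d hd).mapsTo ha) (heq ▸ (hψ d' hd').mapsTo ha')
      subst hdd
      exact (hψ d hd).injOn ha ha' heq
  · rw [image_vertexSet, h.vertexSet, h'.vertexSet, Set.image_union, himgι _ subset_rfl,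
      Set.image_sUnion, Set.image_congr himgd, hΦ.image_eq]
  · have h1 : Set.image f '' (Set.image ι '' E(C)) = Set.image ι' '' E(C) := by
      rw [Set.image_image]
      exact Set.image_congr fun e he => himgι e he.subset_vertexSet
    have h2 : Set.image f '' (insert (ι u) '' D) = insert (ι' u) '' D' := by
      rw [← hΦ.image_eq, Set.image_image, Set.image_image]
      refine Set.image_congr fun d hd => ?_
      rw [Set.image_insert_eq, hfι u hu, himgd d hd]
    rw [image_edgeSet, h.edgeSet, h'.edgeSet, Set.image_union, h1, h2]

end Pendant

/-! ### The hyperstar as a star with `m` leaf sets. -/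

section Hyperstar

theorem hyperstar_isStarAt (m : ℕ) {k : ℕ} (hk : 2 ≤ k) :
    ∃ D, (hyperstar m k).IsStarAt k (Sum.inl 0) D ∧ D.Finite ∧ D.ncard = m := by
  classical
  let S : SimpleGraph (Fin (m + 1)) := SimpleGraph.starGraph 0
  let W := Fin (m + 1) ⊕ (S.edgeSet × Fin (k - 2))
  have hedge : ∀ e : S.edgeSet, ∃ j : Fin (m + 1), j ≠ 0 ∧ (e : Sym2 (Fin (m + 1))) = s(0, j) := by
    rintro ⟨e, he⟩
    induction e using Sym2.ind with
    | _ a b =>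
      obtain ⟨hab, rfl | rfl⟩ := SimpleGraph.starGraph_adj.1 he
      · exact ⟨b, hab.symm, rfl⟩
      · exact ⟨a, hab, Sym2.eq_swap⟩
  choose j hj0 hj using hedge
  have hjinj : Function.Injective j := fun e f h => Subtype.ext (by rw [hj e, hj f, h])
  have hjsurj : ∀ i : Fin (m + 1), i ≠ 0 → ∃ e, j e = i := by
    intro i hi
    have hadj : s(0, i) ∈ S.edgeSet := SimpleGraph.starGraph_adj.2 ⟨hi.symm, Or.inl rfl⟩
    refine ⟨⟨s(0, i), hadj⟩, ?_⟩
    have h1 := hj ⟨s(0, i), hadj⟩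
    simp only [Sym2.eq_iff, true_and] at h1
    obtain h1 | ⟨h1, -⟩ := h1
    · exact h1.symm
    · exact absurd h1.symm (hj0 _)
  -- The leaf set of `e` consists of its outer end `j e` and the `k - 2` vertices added to `e`.
  let leaf : S.edgeSet → Set W := fun e => insert (Sum.inl (j e)) (Sum.inr '' {p | p.1 = e})
  have hmem_inl : ∀ e i, (Sum.inl i : W) ∈ leaf e ↔ i = j e := by
    intro e i
    simp [leaf]
  have hmem_inr : ∀ e p, (Sum.inr p : W) ∈ leaf e ↔ p.1 = e := by
    intro e p
    simp [leaf]
  have hleaf : Function.Injective leaf := fun e f h => by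
    have : (Sum.inl (j e) : W) ∈ leaf f := h ▸ (hmem_inl e _).2 rfl
    exact hjinj ((hmem_inl f _).1 this)
  have hcard : Fintype.card S.edgeSet = m := by
    have := (SimpleGraph.isTree_starGraph (0 : Fin (m + 1))).card_edgeFinset
    rw [SimpleGraph.edgeFinset_card, Fintype.card_fin] at this
    exact Nat.succ_injective this
  refine ⟨Set.range leaf, ⟨?_, ?_, ?_, ?_, ?_⟩, Set.finite_range _, ?_⟩
  · rintro _ ⟨e, rfl⟩ _ ⟨f, rfl⟩ hne
    have hef : e ≠ f := fun h => hne (by rw [h])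
    refine Set.disjoint_left.2 ?_
    rintro (i | p) h1 h2
    · exact hef (hjinj (((hmem_inl e i).1 h1).symm.trans ((hmem_inl f i).1 h2)))
    · exact hef (((hmem_inr e p).1 h1).symm.trans ((hmem_inr f p).1 h2))
  · rintro _ ⟨e, rfl⟩
    have h1 : {p : S.edgeSet × Fin (k - 2) | p.1 = e} = Set.range (Prod.mk e) := by
      ext ⟨a, i⟩
      simp [eq_comm]
    have h2 : ({p : S.edgeSet × Fin (k - 2) | p.1 = e}).encard = (k - 2 : ℕ) := by
      rw [h1, ← Set.image_univ, (Prod.mk_right_injective e).encard_image, Set.encard_univ]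
      simp
    rw [Set.encard_insert_of_notMem (by simp), Sum.inr_injective.encard_image, h2]
    exact_mod_cast (by omega : k - 2 + 1 = k - 1)
  · rintro _ ⟨e, rfl⟩ h
    exact hj0 e ((hmem_inl e 0).1 h).symm
  · refine (Set.eq_univ_of_forall ?_).symm
    rintro (i | p)
    · by_cases hi : i = 0
      · exact Or.inl (by rw [hi])
      · obtain ⟨e, rfl⟩ := hjsurj i hi
        exact Or.inr ⟨leaf e, ⟨e, rfl⟩, (hmem_inl e _).2 rfl⟩
    · exact Or.inr ⟨leaf p.1, ⟨p.1, rfl⟩, (hmem_inr _ p).2 rfl⟩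
  · have h1 : ∀ e : S.edgeSet, insert (Sum.inl 0) (leaf e) =
        (Sum.inl '' {w | w ∈ (e : Sym2 (Fin (m + 1)))} ∪ Sum.inr '' {p | p.1 = e} : Set W) := by
      intro e
      have h2 : {w | w ∈ (e : Sym2 (Fin (m + 1)))} = {0, j e} := by
        ext w
        simp only [hj e, Sym2.mem_iff, Set.mem_ofPred_eq, Set.mem_insert_iff, Set.mem_singleton_iff]
      rw [h2, Set.image_pair, Set.insert_union, Set.singleton_union]
    ext s
    constructor
    · rintro ⟨e, rfl⟩
      exact ⟨leaf e, ⟨e, rfl⟩, h1 e⟩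
    · rintro ⟨_, ⟨e, rfl⟩, rfl⟩
      exact ⟨e, h1 e⟩
  · rw [← Set.image_univ, Set.ncard_image_of_injective _ hleaf, Set.ncard_univ,
      Nat.card_eq_fintype_card, hcard]

end Hyperstar

/-! ### The blown-up odd cycle. -/

section OddCycle

variable {n k : ℕ}

theorem vertexSet_oddCycleBlowUp : V(oddCycleBlowUp n k) = Set.univ := rfl

theorem cycleGraph_adj_add_one (hn : 1 ≤ n) (i : Fin (2 * n + 1)) :
    (SimpleGraph.cycleGraph (2 * n + 1)).Adj i (i + 1) := by
  rw [SimpleGraph.cycleGraph_adj']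
  right
  rw [add_sub_cancel_left, Fin.val_one']
  exact Nat.mod_eq_of_lt (by omega)

theorem encard_fiber (i : Fin (2 * n + 1)) :
    {p : Fin (2 * n + 1) × Fin (k / 2) | p.1 = i}.encard = (k / 2 : ℕ) := by
  have h1 : {p : Fin (2 * n + 1) × Fin (k / 2) | p.1 = i} = Set.range (Prod.mk i) := by
    ext ⟨a, b⟩
    simp [eq_comm]
  rw [h1, ← Set.image_univ, (Prod.mk_right_injective i).encard_image, Set.encard_univ]
  simp

theorem oddCycleBlowUp_isUniform (hk : Even k) : (oddCycleBlowUp n k).IsUniform k := by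
  rintro _ ⟨u, w, huw, rfl⟩
  have hdisj : Disjoint {p : Fin (2 * n + 1) × Fin (k / 2) | p.1 = u} {p | p.1 = w} :=
    Set.disjoint_left.2 fun p h1 h2 => huw.ne (h1.symm.trans h2)
  have : {p : Fin (2 * n + 1) × Fin (k / 2) | p.1 = u ∨ p.1 = w} =
    {p | p.1 = u} ∪ {p | p.1 = w} := rfl
  rw [this, Set.encard_union_eq hdisj, encard_fiber, encard_fiber]
  obtain ⟨j, rfl⟩ := hk
  exact_mod_cast (by omega : (j + j) / 2 + (j + j) / 2 = j + j)

theorem exists_mem_edgeSet_oddCycleBlowUp (hn : 1 ≤ n) (u : Fin (2 * n + 1) × Fin (k / 2)) :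
    ∃ e ∈ E(oddCycleBlowUp n k), u ∈ e :=
  ⟨_, ⟨u.1, u.1 + 1, cycleGraph_adj_add_one hn u.1, rfl⟩, Or.inl rfl⟩

/-- The blown-up cycle is vertex-transitive. -/
theorem oddCycleBlowUp_exists_image_eq (a b : Fin (2 * n + 1) × Fin (k / 2)) :
    ∃ σ : Fin (2 * n + 1) × Fin (k / 2) → Fin (2 * n + 1) × Fin (k / 2), Function.Injective σ ∧
      (oddCycleBlowUp n k).image σ = oddCycleBlowUp n k ∧ σ a = b := by
  -- A rotation of the cycle combined with the same transposition in every fibre; edges are unions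
  -- of whole fibres, so they are preserved.
  let τ : Equiv.Perm (Fin (2 * n + 1) × Fin (k / 2)) :=
    (Equiv.addRight (b.1 - a.1)).prodCongr (Equiv.swap a.2 b.2)
  have hτ : ∀ p, (τ p).1 = p.1 + (b.1 - a.1) := fun p => rfl
  have hadj : ∀ u w c, (SimpleGraph.cycleGraph (2 * n + 1)).Adj u w →
      (SimpleGraph.cycleGraph (2 * n + 1)).Adj (u + c) (w + c) := by
    intro u w c h
    rw [SimpleGraph.cycleGraph_adj'] at h ⊢
    rwa [add_sub_add_right_eq_sub, add_sub_add_right_eq_sub]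
  have himg : ∀ u w, τ '' {p | p.1 = u ∨ p.1 = w} =
      {p | p.1 = u + (b.1 - a.1) ∨ p.1 = w + (b.1 - a.1)} := by
    intro u w
    ext p
    rw [τ.image_eq_preimage_symm, Set.mem_preimage]
    have h1 := hτ (τ.symm p)
    rw [Equiv.apply_symm_apply] at h1
    simp [h1]
  refine ⟨τ, τ.injective, Hypergraph.ext ?_ ?_, ?_⟩
  · rw [image_vertexSet, vertexSet_oddCycleBlowUp, Set.image_univ, τ.range_eq_univ]
  · ext e
    constructor
    · rintro ⟨_, ⟨u, w, huw, rfl⟩, rfl⟩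
      exact ⟨_, _, hadj _ _ _ huw, himg u w⟩
    · rintro ⟨u, w, huw, rfl⟩
      refine ⟨_, ⟨_, _, hadj _ _ (-(b.1 - a.1)) huw, rfl⟩, ?_⟩
      rw [himg, neg_add_cancel_right, neg_add_cancel_right]
  · ext1
    · rw [hτ]
      simp
    · exact Equiv.swap_apply_left _ _

/-- Let `a i` count the vertices of `V₁` in fibre `i`. The `2 * n + 1` numbers `a i + a (i + 1)`
would all be odd, although their sum is twice the sum of the `a i`. -/
theorem oddCycleBlowUp_not_isOddBipartite (hn : 1 ≤ n) :
    ¬ (oddCycleBlowUp n k).IsOddBipartite := by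
  rintro ⟨V₁, -, -, -, h⟩
  let a : Fin (2 * n + 1) → ℕ := fun i =>
    ({p : Fin (2 * n + 1) × Fin (k / 2) | p.1 = i} ∩ V₁).ncard
  have hodd : ∀ i, Odd (a i + a (i + 1)) := by
    intro i
    have hne := (cycleGraph_adj_add_one hn i).ne
    have h1 := h _ ⟨i, i + 1, cycleGraph_adj_add_one hn i, rfl⟩
    have h2 : ({p : Fin (2 * n + 1) × Fin (k / 2) | p.1 = i ∨ p.1 = i + 1} ∩ V₁) =
        ({p | p.1 = i} ∩ V₁) ∪ ({p | p.1 = i + 1} ∩ V₁) := Set.union_inter_distrib_right _ _ _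
    rw [h2, Set.ncard_union_eq] at h1
    · exact h1
    · exact Set.disjoint_left.2 fun p hp hp' => hne (hp.1.symm.trans hp'.1)
  have hsum : ∑ i, (a i + a (i + 1)) = 2 * ∑ i, a i := by
    have h1 : ∑ i, a (i + 1) = ∑ i, a i := Equiv.sum_comp (Equiv.addRight 1) a
    rw [Finset.sum_add_distrib, h1]
    ring
  have h1 : Odd (∑ i, (a i + a (i + 1))) := by
    rw [Finset.odd_sum_iff_odd_card_odd, Finset.filter_true_of_mem fun i _ => hodd i]
    simp
  rw [hsum] at h1
  exact absurd h1 (by simp)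

end OddCycle

/-! ### The extremal argument over a vertex-transitive base. -/

section Minimizing

variable {α₀ α : Type} {k m : ℕ} {C : Hypergraph α₀}

theorem IsRayleighMin.le {G : Hypergraph α} (hk : Even k) (hV : V(G).Finite) {c c' : ℝ}
    (hc : ∀ x, 0 ≤ G.energy k (-c) x) (hc' : IsRayleighMin k G c') : c ≤ c' := by
  obtain ⟨-, x, ⟨v, hv, hx⟩, h2⟩ := hc'
  have h1 := hc x
  have hpos : 0 < ∑ᶠ v ∈ V(G), x v ^ k := by
    rw [finsum_mem_eq_finite_toFinset_sum _ hV]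
    exact Finset.sum_pos' (fun _ _ => hk.pow_nonneg _) ⟨v, hV.mem_toFinset.2 hv, hk.pow_pos hx⟩
  unfold energy at h1 h2
  have h3 : 0 ≤ (c' - c) * ∑ᶠ v ∈ V(G), x v ^ k := by linarith
  linarith [nonneg_of_mul_nonneg_left h3 hpos]

open Classical in
theorem differentiable_energy_update [Fintype α₀] (C : Hypergraph α₀) (k : ℕ) (μ : ℝ) (z : α₀ → ℝ)
    (i : α₀) : Differentiable ℝ fun t => C.energy k μ (Function.update z i t) := by
  have hcoord : ∀ v, Differentiable ℝ fun t => Function.update z i t v := by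
    intro v
    by_cases hv : v = i
    · subst hv
      simp only [Function.update_self]
      exact differentiable_id
    · simp only [Function.update_of_ne hv]
      exact differentiable_const _
  have hen : ∀ t, C.energy k μ (Function.update z i t) =
      k * ∑ s ∈ C.edgeFinsets, ∏ v ∈ s, Function.update z i t v -
        -μ * ∑ v : V(C), Function.update z i t v ^ k := by
    intro t
    have := energy_eq (G := C) k (-μ) (Function.update z i t)
    rwa [neg_neg] at this
  simp only [hen]
  refine Differentiable.sub (Differentiable.const_mul (Differentiable.fun_sum fun s _ => ?_) _)
    (Differentiable.const_mul (Differentiable.fun_sum fun v _ => ?_) _)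
  · exact Differentiable.fun_finsetProd fun v _ => hcoord v
  · exact (hcoord v).pow k

/-- If two vertices both carry the extremal weight, then a minimiser vanishes there. -/
theorem eq_zero_of_energy_eq [Fintype α₀] (hk0 : 0 < k) {μ q : ℝ} (hq : q ≠ 0)
    (hmin : ∀ (u : α₀) z, q * z u ^ k ≤ C.energy k μ z) {z : α₀ → ℝ} {v w : α₀} (hvw : v ≠ w)
    (hv : C.energy k μ z = q * z v ^ k) (hw : C.energy k μ z = q * z w ^ k) : z w = 0 := by
  classical
  have hE := (differentiable_energy_update C k μ z w (z w)).hasDerivAt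
  set L := deriv (fun t => C.energy k μ (Function.update z w t)) (z w)
  -- Varying the coordinate `w` leaves the lower bound at `v` constant but changes the one at `w`.
  -- Both are tight at `z`, so their derivatives must both equal `L`.
  have h1 : L = 0 := by
    refine IsLocalMin.hasDerivAt_eq_zero (Filter.Eventually.of_forall fun t => ?_) hE
    have := hmin v (Function.update z w t)
    rw [Function.update_of_ne hvw, ← hv] at this
    simpa only [Function.update_eq_self] using this
  have h2 : L - q * (k * z w ^ (k - 1)) = 0 := by
    refine IsLocalMin.hasDerivAt_eq_zero (Filter.Eventually.of_forall fun t => ?_)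
      (hE.sub ((hasDerivAt_pow k (z w)).const_mul q))
    have := hmin w (Function.update z w t)
    simp only [Function.update_self, Function.update_eq_self, Pi.sub_apply] at this ⊢
    linarith
  rw [h1, zero_sub, neg_eq_zero] at h2
  have hk' : (k : ℝ) ≠ 0 := by positivity
  exact eq_zero_of_pow_eq_zero ((mul_eq_zero.1 ((mul_eq_zero.1 h2).resolve_left hq)).resolve_left hk')

/-- The coalescence of `C` with a hyperstar, whose centre is identified with `u`. -/
noncomputable def starCoalescence (C : Hypergraph α₀) (k m : ℕ) (u : α₀) :=
  C.coalescence u (hyperstar m k) (Sum.inl 0)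

theorem starCoalescence_attachHypertrees (hk2 : 2 ≤ k) {u : α₀} (hu : u ∈ V(C)) :
    AttachHypertrees k C (C.starCoalescence k m u) Sum.inl := by
  obtain ⟨D, hD, hDfin, -⟩ := hyperstar_isStarAt m hk2
  exact .attach .refl (hD.isUniform (by omega)) (hD.isHypertree hDfin) hu
    (hD.vertexSet ▸ Set.mem_insert _ _)

theorem exists_isPendant_starCoalescence (hk2 : 2 ≤ k) {u : α₀} (hu : u ∈ V(C)) :
    ∃ D, IsPendant k C (C.starCoalescence k m u) Sum.inl u D := by
  obtain ⟨D, hD, -⟩ := hyperstar_isStarAt m hk2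
  exact ⟨_, (isPendant_refl k C u).coalescence hD hu (Or.inr rfl)⟩

theorem ncard_edgeSet_starCoalescence (hk2 : 2 ≤ k) (hVC : V(C).Finite) (u : α₀) :
    E(C.starCoalescence k m u).ncard = E(C).ncard + m := by
  obtain ⟨D, hD, hDfin, hDm⟩ := hyperstar_isStarAt m hk2
  have hT := hD.isHypertree hDfin
  rw [starCoalescence, ncard_edgeSet_coalescence hk2 (hD.isUniform (by omega)) hVC hT.1, hD.ncard,
    hDm]

/-- Eliminating the leaves of the star from the energy. -/
theorem mul_pow_le_energy (hk : Even k) (hk2 : 2 ≤ k) (hVC : V(C).Finite) {u : α₀} (hu : u ∈ V(C))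
    {μ : ℝ} (hμ : 0 < μ) (h : ∀ x, 0 ≤ (C.starCoalescence k m u).energy k μ x) (z : α₀ → ℝ) :
    m * (μ ^ (k - 1))⁻¹ * z u ^ k ≤ C.energy k μ z := by
  obtain ⟨D, hD, hDfin, hDm⟩ := hyperstar_isStarAt m hk2
  obtain ⟨y, hy, hb⟩ := hD.exists_branchEnergy hDfin hk hk2 hμ (z u)
  have h1 := h (Sum.elim z y)
  rw [starCoalescence, energy_coalescence hk2 (hD.isUniform (by omega)) hVC
    (hD.isHypertree hDfin).1 hu] at h1
  have h2 : Sum.elim z y ∘ attachMap u (Sum.inl 0) = y := by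
    ext v
    by_cases hv : v = Sum.inl 0
    · rw [hv, Function.comp_apply, attachMap_self, Sum.elim_inl, hy]
    · rw [Function.comp_apply, attachMap_of_ne u hv, Sum.elim_inr]
  rw [h2, hb, hDm, Sum.elim_comp_inl] at h1
  linarith

/-- A base hypergraph to which hypertrees can be attached. -/
structure IsBase (k : ℕ) (C : Hypergraph α₀) : Prop where
  isUniform : C.IsUniform k
  vertexSet : V(C) = Set.univ
  exists_mem : ∀ u, ∃ e ∈ E(C), u ∈ e
  transitive : ∀ a b, ∃ σ : α₀ → α₀, Function.Injective σ ∧ C.image σ = C ∧ σ a = b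

theorem IsIsomorphic.isRayleighMin {β : Type} {G : Hypergraph α} {H : Hypergraph β}
    (h : G.IsIsomorphic H) {c : ℝ} (hc : IsRayleighMin k G c) : IsRayleighMin k H c := by
  obtain ⟨f, hf, rfl⟩ := h
  exact hc.image hf

theorem starCoalescence_isUniform_and_finite [Fintype α₀] (hk2 : 2 ≤ k) (hC : IsBase k C)
    (u : α₀) : (C.starCoalescence k m u).IsUniform k ∧ V(C.starCoalescence k m u).Finite :=
  ((starCoalescence_attachHypertrees hk2 (hC.vertexSet ▸ Set.mem_univ u)).mapsTo_and
    hC.isUniform (Set.toFinite _)).2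

/-- Transitivity moves the attachment vertex `u` to `w`, and the edge count fixes the number of
pendant edges. -/
theorem isIsomorphic_starCoalescence [Fintype α₀] (hk2 : 2 ≤ k) (hC : IsBase k C)
    {H : Hypergraph α} {ι : α₀ → α} {u : α₀} {D : Set (Set α)} (h : IsPendant k C H ι u D)
    (hH : V(H).Finite) (hm : E(H).ncard = E(C).ncard + m) (w : α₀) :
    H.IsIsomorphic (C.starCoalescence k m w) := by
  have hV : ∀ v, v ∈ V(C) := fun v => hC.vertexSet ▸ Set.mem_univ v
  obtain ⟨σ, hσ, hσC, hσw⟩ := hC.transitive w u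
  obtain ⟨D', hD'⟩ := exists_isPendant_starCoalescence (m := m) hk2 (hV w)
  have h1 := h.ncard hk2 (hV u) (finite_edgeSet hH)
  have h2 := hD'.ncard hk2 (hV w)
    (finite_edgeSet (starCoalescence_isUniform_and_finite hk2 hC w).2)
  rw [ncard_edgeSet_starCoalescence hk2 (Set.toFinite _)] at h2
  exact (h.comp hσ.injOn hσC hσw).isIsomorphic hD' (hV w) h1.2 h2.2 (by omega)

/-- The smallest number `μ` for which the energy of a star coalescence is nonnegative. -/
theorem exists_extremal [Fintype α₀] [Nonempty α₀] (hk : Even k) (hk2 : 2 ≤ k) (hC : IsBase k C)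
    (m : ℕ) : ∃ μ : ℝ, 0 < μ ∧ (m : ℝ) < μ ^ k ∧
      (∀ u, IsRayleighMin k (C.starCoalescence k m u) (-μ)) ∧
      ∀ u z, m * (μ ^ (k - 1))⁻¹ * z u ^ k ≤ C.energy k μ z := by
  have hV : ∀ v, v ∈ V(C) := fun v => hC.vertexSet ▸ Set.mem_univ v
  have u₀ : α₀ := Classical.arbitrary α₀
  have hfin := fun u => starCoalescence_isUniform_and_finite (m := m) hk2 hC u
  have hne : V(C.starCoalescence k m u₀).Nonempty := ⟨Sum.inl u₀, Or.inl ⟨u₀, hV u₀, rfl⟩⟩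
  obtain ⟨c, hc⟩ := exists_isRayleighMin hk (by omega) (hfin u₀).1 (hfin u₀).2 hne
  have hall : ∀ u, IsRayleighMin k (C.starCoalescence k m u) c := by
    intro u
    obtain ⟨D, hD⟩ := exists_isPendant_starCoalescence (m := m) hk2 (hV u₀)
    exact (isIsomorphic_starCoalescence hk2 hC hD (hfin u₀).2
      (ncard_edgeSet_starCoalescence hk2 (Set.toFinite _) u₀) u).isRayleighMin hc
  obtain ⟨e, he, hue⟩ := hC.exists_mem u₀
  have hμ1 : 1 ≤ -c := one_le_of_energy_nonneg hk hk2 (hfin u₀).1 (hfin u₀).2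
    (Or.inl ⟨e, he, rfl⟩) hc.1
  have hμ : 0 < -c := by linarith
  have hmin : ∀ u z, m * ((-c) ^ (k - 1))⁻¹ * z u ^ k ≤ C.energy k (-c) z := fun u z =>
    mul_pow_le_energy hk hk2 (Set.toFinite _) (hV u) hμ (hall u).1 z
  refine ⟨-c, hμ, ?_, by simpa using hall, hmin⟩
  -- On one edge of `C` with ratio `μ⁻¹` the energy is `μ - (μ ^ (k - 1))⁻¹`. Compared with the
  -- lower bound at `u₀` this gives `m + 1 ≤ μ ^ k`, hence the strict inequality needed for the case
  -- of equality.
  obtain ⟨z, hz1, hz⟩ := exists_energy_edge hk hk2 hC.isUniform (Set.toFinite _) he hue (-c) (-c)⁻¹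
  have h1 := hmin u₀ z
  set μ := -c
  have hμk : μ ^ k = μ ^ (k - 1) * μ := (pow_sub_one_mul (by omega) _).symm
  have hp : 0 < μ ^ (k - 1) := by positivity
  rw [hz, hz1, one_pow, mul_one, inv_pow, inv_pow, hμk, Nat.cast_sub (by omega)] at h1
  have h2 : μ * (1 + ((k : ℝ) - (1 : ℕ)) * (μ ^ (k - 1) * μ)⁻¹) - k * (μ ^ (k - 1))⁻¹ =
      (μ ^ (k - 1) * μ - 1) * (μ ^ (k - 1))⁻¹ := by
    field_simp
    push_cast
    ring
  rw [h2] at h1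
  have h3 := le_of_mul_le_mul_right h1 (inv_pos.2 hp)
  rw [hμk]
  linarith

section Extremal

variable [Fintype α₀] {μ : ℝ} {H : Hypergraph α} {ι : α₀ → α} {n : α₀ → ℕ}

theorem sum_weight_mul_pow (n : α₀ → ℕ) (q : ℝ) (z : α₀ → ℝ) (k : ℕ) (a : ℝ) :
    ((∑ v, n v : ℕ) : ℝ) * q * a ^ k - ∑ v, n v * (q * z v ^ k) =
      ∑ v, n v * (q * (a ^ k - z v ^ k)) := by
  rw [Nat.cast_sum, Finset.sum_mul, Finset.sum_mul, ← Finset.sum_sub_distrib]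
  exact Finset.sum_congr rfl fun v _ => by ring

variable [Nonempty α₀]

/-- Moving all the weight to a vertex where `|z|` is maximal does not increase the energy, and there
`hmin` applies. -/
theorem HasWeight.energy_nonneg (h : HasWeight k C H ι n) (hk : Even k) (hμ : 0 < μ)
    (hm : ((∑ v, n v : ℕ) : ℝ) < μ ^ k)
    (hmin : ∀ u z, ((∑ v, n v : ℕ) : ℝ) * (μ ^ (k - 1))⁻¹ * z u ^ k ≤ C.energy k μ z)
    (x : α → ℝ) : 0 ≤ H.energy k μ x := by
  refine le_trans ?_ (h.le μ hμ hm.le x)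
  set z := x ∘ ι
  obtain ⟨u, hu⟩ := Finite.exists_max fun v => |z v|
  have h1 := hmin u z
  have h2 := sum_weight_mul_pow n (μ ^ (k - 1))⁻¹ z k (z u)
  have h3 : 0 ≤ ∑ v, (n v : ℝ) * ((μ ^ (k - 1))⁻¹ * (z u ^ k - z v ^ k)) :=
    Finset.sum_nonneg fun v _ => mul_nonneg (Nat.cast_nonneg _) (mul_nonneg (by positivity)
      (sub_nonneg.2 (pow_le_pow_of_abs_le hk (hu v))))
  unfold weightEnergy
  linarith

/-- Zero energy makes every inequality in the proof of nonnegativity tight. So weight occurs only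
where `|z|` is maximal, and by `eq_zero_of_energy_eq` at no more than one vertex. -/
theorem HasWeight.exists_isPendant (h : HasWeight k C H ι n) (hk : Even k) (hk0 : 0 < k)
    (hμ : 0 < μ) (hm : ((∑ v, n v : ℕ) : ℝ) < μ ^ k)
    (hmin : ∀ u z, ((∑ v, n v : ℕ) : ℝ) * (μ ^ (k - 1))⁻¹ * z u ^ k ≤ C.energy k μ z)
    {x : α → ℝ} (hx : ∃ v ∈ V(H), x v ≠ 0) (hx0 : H.energy k μ x = 0) :
    ∃ u D, IsPendant k C H ι u D := by
  have hle := h.le μ hμ hm.le x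
  have hpendant := h.isPendant μ hμ hm x
  have hzero := h.eq_zero μ hμ hm x
  set z := x ∘ ι with hz
  set q := (μ ^ (k - 1))⁻¹
  have hq : 0 < q := by positivity
  obtain ⟨u, hu⟩ := Finite.exists_max fun v => |z v|
  have h1 := hmin u z
  have h2 := sum_weight_mul_pow n q z k (z u)
  have h3 : ∀ v ∈ Finset.univ, 0 ≤ (n v : ℝ) * (q * (z u ^ k - z v ^ k)) := fun v _ =>
    mul_nonneg (Nat.cast_nonneg _) (mul_nonneg hq.le
      (sub_nonneg.2 (pow_le_pow_of_abs_le hk (hu v))))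
  have h4 := Finset.sum_nonneg h3
  have h5 : C.weightEnergy k μ n z = C.energy k μ z - ∑ v, n v * (q * z v ^ k) := rfl
  have heq : C.weightEnergy k μ n z = H.energy k μ x := by linarith
  have hsum0 : ∑ v, (n v : ℝ) * (q * (z u ^ k - z v ^ k)) = 0 := by linarith
  have hzu : z u ≠ 0 := by
    intro hzu
    obtain ⟨w, hw, hxw⟩ := hx
    refine hxw (hzero heq (fun v _ => ?_) w hw)
    have := hu v
    rwa [hzu, abs_zero, abs_nonpos_iff] at this
  have hmax : ∀ v, 0 < n v → z v ^ k = z u ^ k := by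
    intro v hv
    have h6 := (Finset.sum_eq_zero_iff_of_nonneg h3).1 hsum0 v (Finset.mem_univ v)
    have h7 : (n v : ℝ) ≠ 0 := by exact_mod_cast hv.ne'
    have := (mul_eq_zero.1 ((mul_eq_zero.1 h6).resolve_left h7)).resolve_left hq.ne'
    linarith
  have hne : ∀ v, 0 < n v → z v ≠ 0 := fun v hv hzv => by
    have h6 := hmax v hv
    rw [hzv, zero_pow hk0.ne'] at h6
    exact hzu (eq_zero_of_pow_eq_zero h6.symm)
  have huniq : ∀ v w, 0 < n v → 0 < n w → w = v := by
    intro v w hv hw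
    by_contra hvw
    have hq' : ((∑ v, n v : ℕ) : ℝ) * q ≠ 0 := by
      have h6 : 0 < ∑ v, n v := Finset.sum_pos' (fun _ _ => Nat.zero_le _) ⟨v, Finset.mem_univ v, hv⟩
      have : (0 : ℝ) < (∑ v, n v : ℕ) := by exact_mod_cast h6
      positivity
    refine hne w hw (eq_zero_of_energy_eq hk0 hq' hmin (Ne.symm hvw) ?_ ?_)
    · rw [hmax v hv]
      linarith
    · rw [hmax w hw]
      linarith
  -- Without any weight there is nothing to localise and any vertex serves.
  by_cases hex : ∃ v, 0 < n v
  · obtain ⟨v, hv⟩ := hex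
    exact ⟨v, hpendant heq v fun w hw => ⟨huniq v w hv hw, hne v hv⟩⟩
  · exact ⟨u, hpendant heq u fun w hw => absurd ⟨w, hw⟩ hex⟩

end Extremal

theorem MemT.exists_hasWeight [Fintype α₀] (hk : Even k) (hk2 : 2 ≤ k) (hC : C.IsUniform k)
    {G : Hypergraph α} (h : MemT k m C G) : ∃ (β : Type) (H : Hypergraph β) (ι : α₀ → β)
      (n : α₀ → ℕ), HasWeight k C H ι n ∧ ∑ v, n v = m ∧ H.IsUniform k ∧ V(H).Finite ∧
      E(H).ncard = E(C).ncard + m ∧ Set.MapsTo ι V(C) V(H) ∧ H.IsIsomorphic G := by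
  obtain ⟨β, H, ι, hatt, hm, hiso⟩ := h
  obtain ⟨n, hn⟩ := hatt.exists_hasWeight hk hk2 hC
  obtain ⟨h1, h2, h3⟩ := hatt.mapsTo_and hC (Set.toFinite _)
  have := hn.ncard
  exact ⟨β, H, ι, n, hn, by omega, h2, h3, hm, h1, hiso⟩

/-- The minimizing hypergraphs over a vertex-transitive base are the coalescences with a
hyperstar. -/
theorem IsBase.isMinimizing_iff [Fintype α₀] (hC : IsBase k C) (hk : Even k) (hk2 : 2 ≤ k)
    (u : α₀) (G : Hypergraph α) :
    IsMinimizing k m C G ↔ G.IsIsomorphic (C.starCoalescence k m u) := by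
  have : Nonempty α₀ := ⟨u⟩
  have hk0 : 0 < k := by omega
  have hV : ∀ v, v ∈ V(C) := fun v => hC.vertexSet ▸ Set.mem_univ v
  obtain ⟨μ, hμ, hm, hS, hmin⟩ := exists_extremal hk hk2 hC m
  have hSfin := starCoalescence_isUniform_and_finite (m := m) hk2 hC u
  have hmem : ∀ (β : Type) (K : Hypergraph β), (C.starCoalescence k m u).IsIsomorphic K →
      MemT k m C K := fun β K hK =>
    ⟨_, _, _, starCoalescence_attachHypertrees hk2 (hV u),
      ncard_edgeSet_starCoalescence hk2 (Set.toFinite _) u, hK⟩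
  have hleast : ∀ (β : Type) (K : Hypergraph β), MemT k m C K →
      ∃ c, IsRayleighMin k K c ∧ IsLeastHEigenvalue k K c ∧ -μ ≤ c := by
    intro β K hK
    obtain ⟨γ, H, ι, n, hn, rfl, hHu, hHV, -, hmaps, hiso⟩ := hK.exists_hasWeight hk hk2 hC.isUniform
    obtain ⟨c, hc⟩ := exists_isRayleighMin hk hk0 hHu hHV ⟨ι u, hmaps (hV u)⟩
    have hle : -μ ≤ c := IsRayleighMin.le hk hHV
      (fun x => by rw [neg_neg]; exact hn.energy_nonneg hk hμ hm hmin x) hc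
    obtain ⟨f, hf, rfl⟩ := hiso
    exact ⟨c, hc.image hf, (isLeastHEigenvalue_iff hk hk0 (hHu.image hf) (hHV.image f)).2
      (hc.image hf), hle⟩
  constructor
  · rintro ⟨hG, c, hc, hcmin⟩
    obtain ⟨c', hc', hc'', hle⟩ := hleast _ G hG
    obtain ⟨d, hd, hcd⟩ := hcmin _ (C.starCoalescence k m u) (hmem _ _ ⟨id, Set.injOn_id _, by
      exact image_eq_self fun _ _ => rfl⟩)
    obtain ⟨β, H, ι, n, hn, rfl, hHu, hHV, hHm, hmaps, hiso⟩ := hG.exists_hasWeight hk hk2 hC.isUniform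
    have hHG := hiso
    obtain ⟨f, hf, rfl⟩ := hiso
    have hGc : IsRayleighMin k (H.image f) c :=
      (isLeastHEigenvalue_iff hk hk0 (hHu.image hf) (hHV.image f)).1 hc
    have hd' := (isLeastHEigenvalue_iff hk hk0 hSfin.1 hSfin.2).1 hd
    have hdμ : d ≤ -μ := IsRayleighMin.le hk hSfin.2 hd'.1 (hS u)
    have hcc : c' ≤ c := IsRayleighMin.le hk (hHV.image f) hc'.1 hGc
    -- The chain `c ≤ d ≤ -μ ≤ c' ≤ c` closes up.
    have hcμ : c = -μ := by linarith
    subst hcμ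
    obtain ⟨-, x, ⟨_, ⟨v, hv, rfl⟩, hxv⟩, hx0⟩ := hGc
    rw [neg_neg, energy_image hf] at hx0
    obtain ⟨w, D, hD⟩ := hn.exists_isPendant hk hk0 hμ hm hmin ⟨v, hv, hxv⟩ hx0
    exact (hHG.symm ⟨v, hv⟩).trans (isIsomorphic_starCoalescence hk2 hC hD hHV hHm u)
  · intro hG
    have hne : V(C.starCoalescence k m u).Nonempty := ⟨Sum.inl u, Or.inl ⟨u, hV u, rfl⟩⟩
    have hGne : V(G).Nonempty := by
      obtain ⟨f, -, hf⟩ := hG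
      rw [← hf, image_vertexSet] at hne
      exact hne.of_image
    have hSG := hG.symm hGne
    have hGc := hSG.isRayleighMin (hS u)
    refine ⟨hmem _ _ hSG, -μ, ?_, fun β K hK => ?_⟩
    · obtain ⟨f, hf, rfl⟩ := hSG
      exact (isLeastHEigenvalue_iff hk hk0 (hSfin.1.image hf) (hSfin.2.image f)).2 hGc
    · obtain ⟨c, -, hc, hle⟩ := hleast β K hK
      exact ⟨c, hc, hle⟩

end Minimizing

theorem oddCycleBlowUp_isBase {n k : ℕ} (hk : Even k) (hn : 1 ≤ n) :
    IsBase k (oddCycleBlowUp n k) :=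
  ⟨oddCycleBlowUp_isUniform hk, vertexSet_oddCycleBlowUp, exists_mem_edgeSet_oddCycleBlowUp hn,
    oddCycleBlowUp_exists_image_eq⟩

end Hypergraph

theorem corollary4p4 (k n m : ℕ) (hk : Even k) (hk4 : 4 ≤ k) (hn : 1 ≤ n) :
    ¬ (Hypergraph.oddCycleBlowUp n k).IsOddBipartite ∧
    ∀ (u : Fin (2 * n + 1) × Fin (k / 2)) (α : Type) (G : Hypergraph α),
      Hypergraph.IsMinimizing k m (Hypergraph.oddCycleBlowUp n k) G ↔
        G.IsIsomorphic
          ((Hypergraph.oddCycleBlowUp n k).coalescence u (Hypergraph.hyperstar m k) (Sum.inl 0)) :=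
  ⟨Hypergraph.oddCycleBlowUp_not_isOddBipartite hn, fun u _ G =>
    (Hypergraph.oddCycleBlowUp_isBase hk hn).isMinimizing_iff hk (by omega) u G⟩
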